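/- **Theorem.** Let $\gamma>1$, $B>0$, and let the viscosity coefficient $\mu\in C^1([0,\infty))$ satisfy $B^{-1}\le\mu\le B$ and $\mu'\le B$. Consider the Cauchy problem on $\mathbb R$ for the one-dimensional pressureless Euler–compressible Navier–Stokes system $$\begin{cases}\rho_t+(\rho u)_x=0,\\ (\rho u)_t+(\rho u^2)_x=-\rho(u-w),\\ n_t+(nw)_x=0,\\ (nw)_t+(nw^2)_x+(n^\gamma)_x=(\mu(n)w_x)_x+\rho(u-w),\end{cases}\qquad (\rho,u,n,w)|_{t=0}=(\rho_0,u_0,n_0,w_0).$$ Let $\Omega_1,\Omega_2\subseteq\mathbb R$ be open with $\Omega_1\cup\Omega_2=(0,1)$, $\operatorname{supp}\rho_0=\overline{\Omega_1}$, $\rho_0>0$ in $\Omega_1$, $\operatorname{supp}n_0=\overline{\Omega_2}$, $n_0>0$ in $\Omega_2$. Let $K,M>0$ be constants such that in $(0,1)$ the functions $n_0$, $u_0$, $w_0$, $(u_0)_x$, $(w_0)_x$ are differentiable, $\rho_0+n_0+|(n_0)_x|<K$, and each of $|u_0|,|(u_0)_x|,|(u_0)_{xx}|,|w_0|,|(w_0)_x|,|(w_0)_{xx}|$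 is $<M$. For constants $p_0>0$ and $d_0\in(0,1)$ consider the conditions (L) $\ (n_0)_x/n_0\ge p_0$ and $w_0\le 0$ in $(0,d_0]$, and $w_0(d_0)<0$; (R) $\ (n_0)_x/n_0\le -p_0$ and $w_0\ge 0$ in $[1-d_0,1)$, and $w_0(1-d_0)>0$. Suppose that one of the following holds: 1. $\Omega_1\subsetneq\Omega_2$, and either (L) holds and $\rho_0$ vanishes near the end point $0$ (that is, $0\notin\overline{\Omega_1}$), or (R) holds and $\rho_0$ vanishes near the end point $1$ (that is, $1\notin\overline{\Omega_1}$); 2. $\Omega_1=\Omega_2$, (L) or (R) holds, and in addition $$\frac{n_0^\gamma}{\rho_0}\ge\frac{2^{\gamma+4}M}{\gamma p_0}\quad\text{in }(0,d_0)\cup(1-d_0,1).$$ Then for every $T>0$ and every real $m>2$ the Cauchy problem has no solution $(\rho,u,n,w)$ on $\mathbb R\times[0,T]$ all of whose components belong to $C^1([0,T];H^m(\mathbb R))$. -/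

import Mathlib

open Set MeasureTheory

/-- `f ∈ C¹([0,T]; H^m(ℝ))`, for a real order `m` and a function `f t x` of time and space.
`H^m(ℝ)` carries the norm that makes the Bessel potential of order `m` an isometry of `H^m(ℝ)`
onto `L²(ℝ)`; so `f` is of class `C¹` in time with values in `H^m(ℝ)` iff the curve `G` of the
Bessel potentials of its values is of class `C¹` in time (one-sided at the end points) with values
in `L²(ℝ)`. Each `f t` is the continuous representative of its class. -/
def IsC1Sobolev (m T : ℝ) (f : ℝ → ℝ → ℝ) : Prop :=
  ∃ G : ℝ → Lp ℂ 2 (volume : Measure ℝ), ContDiffOn ℝ 1 G (Icc 0 T) ∧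
    ∀ t ∈ Icc (0 : ℝ) T, Continuous (f t) ∧
      ∃ h : MemLp (fun x => (f t x : ℂ)) 2 (volume : Measure ℝ),
        TemperedDistribution.besselPotential ℝ ℂ m (Lp.toTemperedDistribution (h.toLp _)) =
          Lp.toTemperedDistribution (G t)

/-- `(ρ, u, n, w)` is a solution on `ℝ × [0,T]`, in the class `C¹([0,T]; H^m(ℝ))`, of the Cauchy
problem for the one-dimensional pressureless Euler / compressible Navier-Stokes system with
pressure `n ^ γ`, viscosity `mu n` and drag force `ρ (u - w)`. The last momentum equation also
asserts that the viscous flux `mu n * w_x` is differentiable in space. -/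
structure IsTwoPhaseSolution (mu : ℝ → ℝ) (γ m T : ℝ) (ρ₀ u₀ n₀ w₀ : ℝ → ℝ)
    (ρ u n w : ℝ → ℝ → ℝ) : Prop where
  reg_ρ : IsC1Sobolev m T ρ
  reg_u : IsC1Sobolev m T u
  reg_n : IsC1Sobolev m T n
  reg_w : IsC1Sobolev m T w
  euler_mass : ∀ t ∈ Ioo (0 : ℝ) T, ∀ x : ℝ,
    deriv (fun s => ρ s x) t + deriv (fun y => ρ t y * u t y) x = 0
  euler_momentum : ∀ t ∈ Ioo (0 : ℝ) T, ∀ x : ℝ,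
    deriv (fun s => ρ s x * u s x) t + deriv (fun y => ρ t y * u t y ^ 2) x =
      -(ρ t x * (u t x - w t x))
  ns_mass : ∀ t ∈ Ioo (0 : ℝ) T, ∀ x : ℝ,
    deriv (fun s => n s x) t + deriv (fun y => n t y * w t y) x = 0
  ns_flux : ∀ t ∈ Ioo (0 : ℝ) T, ∀ x : ℝ,
    DifferentiableAt ℝ (fun y => mu (n t y) * deriv (w t) y) x
  ns_momentum : ∀ t ∈ Ioo (0 : ℝ) T, ∀ x : ℝ,
    deriv (fun s => n s x * w s x) t + deriv (fun y => n t y * w t y ^ 2) x +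
        deriv (fun y => n t y ^ γ) x =
      deriv (fun y => mu (n t y) * deriv (w t) y) x + ρ t x * (u t x - w t x)
  init_ρ : ∀ x, ρ 0 x = ρ₀ x
  init_u : ∀ x, u 0 x = u₀ x
  init_n : ∀ x, n 0 x = n₀ x
  init_w : ∀ x, w 0 x = w₀ x

/-- The viscosity coefficient is `C¹` on `[0,∞)` with values in `[B⁻¹, B]` and `mu' ≤ B`. -/
def ViscosityBounds (mu : ℝ → ℝ) (B : ℝ) : Prop :=
  ContDiffOn ℝ 1 mu (Ici 0) ∧
    ∀ s ∈ Ici (0 : ℝ), B⁻¹ ≤ mu s ∧ mu s ≤ B ∧ derivWithin mu (Ici 0) s ≤ B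

/-- The function `f` is positive on `Ω` and has support the closure of `Ω`. -/
def IsSupportedOn (f : ℝ → ℝ) (Ω : Set ℝ) : Prop :=
  tsupport f = closure Ω ∧ ∀ x ∈ Ω, 0 < f x

/-- The pointwise bounds on the initial densities, by `K`, and on the initial velocities and
their derivatives up to order two, by `M`, in `(0,1)`. -/
structure InitialBounds (ρ₀ u₀ n₀ w₀ : ℝ → ℝ) (K M : ℝ) : Prop where
  diff_n : DifferentiableOn ℝ n₀ (Ioo 0 1)
  diff_u : DifferentiableOn ℝ u₀ (Ioo 0 1)
  diff_u' : DifferentiableOn ℝ (deriv u₀) (Ioo 0 1)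
  diff_w : DifferentiableOn ℝ w₀ (Ioo 0 1)
  diff_w' : DifferentiableOn ℝ (deriv w₀) (Ioo 0 1)
  density : ∀ x ∈ Ioo (0 : ℝ) 1, ρ₀ x + n₀ x + |deriv n₀ x| < K
  velocity_u : ∀ x ∈ Ioo (0 : ℝ) 1,
    |u₀ x| < M ∧ |deriv u₀ x| < M ∧ |deriv (deriv u₀) x| < M
  velocity_w : ∀ x ∈ Ioo (0 : ℝ) 1,
    |w₀ x| < M ∧ |deriv w₀ x| < M ∧ |deriv (deriv w₀) x| < M

/-- The sign condition near the left end point `0`. -/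
def LeftCondition (n₀ w₀ : ℝ → ℝ) (p₀ d₀ : ℝ) : Prop :=
  (∀ x ∈ Ioc (0 : ℝ) d₀, p₀ ≤ deriv n₀ x / n₀ x) ∧ w₀ d₀ < 0 ∧ ∀ x ∈ Ioc (0 : ℝ) d₀, w₀ x ≤ 0

/-- The mirror sign condition near the right end point `1`. -/
def RightCondition (n₀ w₀ : ℝ → ℝ) (p₀ d₀ : ℝ) : Prop :=
  (∀ x ∈ Ico (1 - d₀) 1, deriv n₀ x / n₀ x ≤ -p₀) ∧ 0 < w₀ (1 - d₀) ∧
    ∀ x ∈ Ico (1 - d₀) 1, 0 ≤ w₀ x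

/-! Two incompatible speeds force the contradiction. Both densities are carried by bounded
velocities, so at time `t` the half-line `x < -(C * t)` is still vacuum. There the second momentum
equation degenerates to `a w_xx = 0`; hence `w` is affine, and it vanishes because it decays at
infinity (`TwoPhaseFlow.w_eq_zero`). The viscosity, however, stays bounded below even in vacuum, so
negative values of `w` spread to the left with arbitrary speed (`TwoPhaseFlow.exists_neg`). It
remains to make `w` nonpositive near the end point `0` and strictly negative at some place, on an
arbitrarily short time interval.

Strict negativity comes from the pressure: at an interior point of the layer its gradient strictly
beats the drag, so `w ≤ -ε t` nearby (`TwoPhaseFlow.exists_push`). Nonpositivity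
(`TwoPhaseFlow.w_nonpos`) follows from comparison with small positive barriers, provided that `ρ u`
is dominated by the pressure gradient wherever `u` exceeds the barrier. Three facts give this
domination. The growth `n_x ≥ (p/2) n` persists for a short time (`TwoPhaseFlow.slope_n`). Along its
own path `u` relaxes towards `w`, so if `u` lies above a suitable barrier for `w` now, it did so at
all earlier times; the first phase was then the faster one, and its path did not start to the right
of the path of the second (`TwoPhaseFlow.paths_ordered`). Since `n₀` increases in the layer, the
initial bound of `ρ₀` by `n₀ ^ γ` at the left starting point carries over to time `t`
(`TwoPhaseFlow.drag_le`).

All comparisons go through `TwoPhaseFlow.lt_barrier`. Sobolev embedding supplies the needed `C¹`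
bounds. In the first case of the theorem `ρ₀` vanishes near the end point and the initial drag bound
is trivial; in the second it is the ratio condition. The right end point reduces to the left one by
reflection. -/

/-! ### Sobolev embedding of `H^m(ℝ)` into `C¹` by Fourier inversion -/

theorem memLp_one_add_sq_rpow {s : ℝ} (hs : 1 < 2 * s) :
    MemLp (fun x : ℝ => (((1 + ‖x‖ ^ 2) ^ (-s / 2) : ℝ) : ℂ)) 2 := by
  have : MemLp (fun x : ℝ ↦ (1 + ‖x‖ ^ 2) ^ (-s / 2)) 2 := by
    constructor
    · have : (fun x : ℝ ↦ (1 + ‖x‖ ^ 2) ^ (-s / 2)).HasTemperateGrowth := by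
        fun_prop
      exact this.1.continuous.aestronglyMeasurable
    · rw [eLpNorm_lt_top_iff_lintegral_rpow_enorm_lt_top (by norm_num) (by norm_num)]
      suffices h : ∫⁻ a : ℝ, ENNReal.ofReal ‖(1 + ‖a‖ ^ 2) ^ (-s)‖ < ⊤ from by
        norm_cast
        simp_rw [ofReal_norm] at h
        simp_rw [← enorm_pow]
        convert h
        rw [← Real.rpow_mul_natCast (by positivity)]
        simp
      have hs' : (Module.finrank ℝ ℝ : ℝ) < 2 * s := by simpa using hs
      apply ((integrable_rpow_neg_one_add_norm_sq hs').congr _).lintegral_lt_top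
      filter_upwards with x
      rw [Real.norm_eq_abs (_ ^ _), abs_eq_self.mpr (by positivity)]
      congr 1
      ring
  exact this.ofReal

/-- The factor `x` is absorbed by `|x| ≤ (1 + x²)^(1/2)`, which lowers the order by one. This is the
multiplier of the space derivative. -/
theorem memLp_mul_one_add_sq_rpow {s : ℝ} (hs : 3 < 2 * s) :
    MemLp (fun x : ℝ => (x : ℂ) * (((1 + ‖x‖ ^ 2) ^ (-s / 2) : ℝ) : ℂ)) 2 := by
  refine (memLp_one_add_sq_rpow (s := s - 1) (by linarith)).mono ?_ ?_
  · have h : (fun x : ℝ ↦ (1 + ‖x‖ ^ 2) ^ (-s / 2)).HasTemperateGrowth := by fun_prop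
    have h2 := h.1.continuous
    exact Continuous.aestronglyMeasurable (by fun_prop)
  · filter_upwards with x
    have h1 : (0:ℝ) < 1 + ‖x‖ ^ 2 := by positivity
    rw [norm_mul, Complex.norm_real, Complex.norm_real, Complex.norm_real,
      Real.norm_of_nonneg (by positivity : (0:ℝ) ≤ (1 + ‖x‖ ^ 2) ^ (-s / 2)),
      Real.norm_of_nonneg (by positivity : (0:ℝ) ≤ (1 + ‖x‖ ^ 2) ^ (-(s-1) / 2)),
      show -(s - 1) / 2 = 1 / 2 + -s / 2 by ring, Real.rpow_add h1]
    gcongr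
    rw [← Real.sqrt_eq_rpow]
    apply Real.le_sqrt_of_sq_le
    linarith

open FourierTransform TemperedDistribution ContinuousLinearMap in
/-- The inverse Fourier transform of `b * 𝓕 g` for a fixed `b ∈ L²`, as an operator from `L²` to
bounded continuous functions. -/
noncomputable def fourierSynthesis (b : Lp ℂ 2 (volume : Measure ℝ)) :
    Lp ℂ 2 (volume : Measure ℝ) →L[ℂ] BoundedContinuousFunction ℝ ℂ :=
  Real.Lp.fourierTransformInvCLM ℝ ℂ ∘L ((lsmul ℂ ℂ).holderL volume 2 2 1 b) ∘L
    fourierCLM ℂ (Lp ℂ 2 (volume : Measure ℝ))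

open FourierTransform TemperedDistribution ContinuousLinearMap in
theorem fourierSynthesis_apply {b : ℝ → ℂ} (hb : MemLp b 2) (g : Lp ℂ 2 (volume : Measure ℝ)) :
    (fourierSynthesis (hb.toLp b) g : ℝ → ℂ) =
      𝓕⁻ (fun ξ => b ξ * (𝓕 g : Lp ℂ 2 (volume : Measure ℝ)) ξ) := by
  ext x
  simp only [fourierSynthesis, comp_apply, Real.Lp.fourierTransformInvCLM_apply,
    Real.Lp.fourierTransformInv_apply]
  apply Real.fourierInv_congr_ae
  filter_upwards [coeFn_holder (r := 1) (lsmul ℂ ℂ) (hb.toLp b)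
    (𝓕 g : Lp ℂ 2 (volume : Measure ℝ)), hb.coeFn_toLp] with ξ h1 h2
  change (holder 1 (lsmul ℂ ℂ) (hb.toLp b) (𝓕 g : Lp ℂ 2 (volume : Measure ℝ))) ξ = _
  rw [h1, h2]
  simp

open FourierTransform in
theorem hasDerivAt_fourierInv {f : ℝ → ℂ} (hf : Integrable f)
    (hf' : Integrable (fun x : ℝ => x • f x)) (x : ℝ) :
    HasDerivAt (𝓕⁻ f) (𝓕⁻ (fun ξ : ℝ => (2 * Real.pi * Complex.I * ξ) * f ξ) x) x := by
  have h := Real.hasDerivAt_fourier hf hf' (-x)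
  have h2 := h.scomp x (hasDerivAt_neg x)
  have e : (𝓕⁻ f) = 𝓕 f ∘ Neg.neg := by
    ext y; simp [Real.fourierInv_eq_fourier_neg]
  rw [e]
  refine h2.congr_deriv ?_
  symm
  rw [Real.fourierInv_eq_fourier_neg, neg_one_smul, Real.fourier_real_eq, Real.fourier_real_eq,
    ← integral_neg]
  congr 1
  ext ξ
  simp [Circle.smul_def]

-- The Riemann–Lebesgue lemma; it later provides the decay of `w` at infinity.
open FourierTransform in
theorem tendsto_fourierInv_cocompact (f : ℝ → ℂ) :
    Filter.Tendsto (𝓕⁻ f) (Filter.cocompact ℝ) (nhds 0) := by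
  have e : (𝓕⁻ f) = 𝓕 f ∘ Neg.neg := by
    ext y; simp [Real.fourierInv_eq_fourier_neg]
  rw [e]
  exact (Real.zero_at_infty_fourier f).comp (Homeomorph.neg ℝ).isClosedEmbedding.tendsto_cocompact

open FourierTransform TemperedDistribution in
/-- A continuous function in `L²` whose Fourier transform is integrable is the inverse Fourier
transform of the latter. -/
theorem eq_fourierInv_of_fourier_eq {f : ℝ → ℂ} (hf : MemLp f 2) (hc : Continuous f)
    (v : Lp ℂ 1 (volume : Measure ℝ))
    (h : 𝓕 (Lp.toTemperedDistribution (hf.toLp f)) = Lp.toTemperedDistribution v) (x : ℝ) :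
    f x = 𝓕⁻ (v : ℝ → ℂ) x := by
  have hv : Integrable (v : ℝ → ℂ) := L1.integrable_coeFn v
  have hvc : Continuous (𝓕⁻ (v : ℝ → ℂ)) := by
    have := (Real.Lp.fourierTransformInv v).continuous
    rwa [Real.Lp.coe_fourierTransformInv] at this
  have key : ∀ φ : SchwartzMap ℝ ℂ, ∫ y, φ y • f y = ∫ y, φ y • 𝓕⁻ (v : ℝ → ℂ) y := by
    intro φ
    have h1 : Lp.toTemperedDistribution (hf.toLp f) φ = Lp.toTemperedDistribution v (𝓕⁻ φ) := by
      rw [← h, TemperedDistribution.fourier_apply, fourier_fourierInv_eq]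
    rw [Lp.toTemperedDistribution_apply, Lp.toTemperedDistribution_apply] at h1
    have h2 : ∫ y, φ y • f y = ∫ y, φ y • hf.toLp f y := by
      apply integral_congr_ae
      filter_upwards [hf.coeFn_toLp] with y hy
      rw [hy]
    rw [h2, h1]
    -- Self-adjointness of the Fourier integral. The sign in the bilinear form turns it into the
    -- inverse transform, which moves from `φ` to `v`.
    have := VectorFourier.integral_fourierIntegral_smul_eq_flip (e := Real.fourierChar)
      (μ := (volume : Measure ℝ)) (ν := (volume : Measure ℝ)) (L := -(innerₗ ℝ))
      (f := φ) (g := (v : ℝ → ℂ)) Real.continuous_fourierChar (by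
        simp only [LinearMap.neg_apply, innerₗ_apply_apply]
        exact (continuous_fst.inner continuous_snd).neg) φ.integrable hv
    rw [SchwartzMap.fourierInv_coe]
    convert this using 1
    refine integral_congr_ae (Filter.Eventually.of_forall fun y => ?_)
    dsimp only
    congr 1
    simp only [FourierTransformInv.fourierInv, VectorFourier.fourierIntegral]
    congr 1
    ext ξ
    simp [mul_comm]
  have hae : f =ᵐ[volume] 𝓕⁻ (v : ℝ → ℂ) := by
    apply ae_eq_of_integral_contDiff_smul_eq hc.locallyIntegrable hvc.locallyIntegrable
    intro g hg1 hg2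
    have hg₁ : HasCompactSupport (Complex.ofRealCLM ∘ g) := hg2.comp_left rfl
    have hg₂ : ContDiff ℝ (⊤ : ℕ∞) (Complex.ofRealCLM ∘ g) := by fun_prop
    have := key (hg₁.toSchwartzMap hg₂)
    simpa using this
  exact congrFun ((hc.ae_eq_iff_eq volume hvc).1 hae) x

open FourierTransform TemperedDistribution in
/-- Fourier transform of a function from its Bessel potential. -/
theorem fourier_eq_of_besselPotential {m : ℝ} (hm : 1 < 2 * m)
    {h g : Lp ℂ 2 (volume : Measure ℝ)}
    (hg : besselPotential ℝ ℂ m (Lp.toTemperedDistribution h) = Lp.toTemperedDistribution g) :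
    𝓕 (Lp.toTemperedDistribution h) = Lp.toTemperedDistribution
      ((memLp_one_add_sq_rpow hm).toLp _ • (𝓕 g : Lp ℂ 2 (volume : Measure ℝ)) :
        Lp ℂ 1 (volume : Measure ℝ)) := by
  have h1 := congrArg (fun F => 𝓕 F) hg
  simp only [fourier_besselPotential_eq_smulLeftCLM_fourier_apply] at h1
  rw [Lp.fourier_toTemperedDistribution_eq g] at h1
  rw [MeasureTheory.Lp.toTemperedDistribution_smul_eq]
  -- The multipliers of orders `m` and `-m` cancel.
  · rw [← h1, smulLeftCLM_smulLeftCLM_apply (by fun_prop) (by fun_prop)]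
    convert! (smulLeftCLM_const 1 (𝓕 (Lp.toTemperedDistribution h))).symm using 1
    · simp
    · congr
      ext x
      rw [Pi.mul_apply]
      norm_cast
      rw [← Real.rpow_add (by positivity)]
      ring_nf
      simp
  · fun_prop

open FourierTransform TemperedDistribution in
/-- Sobolev embedding of `H^m(ℝ)` into `C¹`, for `m > 3/2`, in terms of Bessel potentials. -/
theorem exists_sobolev_embedding {m : ℝ} (hm : 3 < 2 * m) :
    ∃ S₀ S₁ : Lp ℂ 2 (volume : Measure ℝ) →L[ℂ] BoundedContinuousFunction ℝ ℂ,
      (∀ g x, HasDerivAt (S₀ g) (S₁ g x) x) ∧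
      (∀ g, Filter.Tendsto (S₀ g) (Filter.cocompact ℝ) (nhds 0)) ∧
      ∀ (f : ℝ → ℂ) (hf : MemLp f 2) (g : Lp ℂ 2 (volume : Measure ℝ)), Continuous f →
        besselPotential ℝ ℂ m (Lp.toTemperedDistribution (hf.toLp f)) =
          Lp.toTemperedDistribution g → ∀ x, f x = S₀ g x := by
  have hb := memLp_one_add_sq_rpow (s := m) (by linarith)
  have hb1 := memLp_mul_one_add_sq_rpow hm
  set b : ℝ → ℂ := fun x : ℝ => (((1 + ‖x‖ ^ 2) ^ (-m / 2) : ℝ) : ℂ) with hbdef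
  have hb2 := hb1.const_mul (2 * Real.pi * Complex.I)
  refine ⟨fourierSynthesis (hb.toLp b), fourierSynthesis (hb2.toLp _), ?_, ?_, ?_⟩
  · intro g x
    rw [fourierSynthesis_apply, fourierSynthesis_apply]
    have hg := Lp.memLp (𝓕 g : Lp ℂ 2 (volume : Measure ℝ))
    have i1 : Integrable (fun ξ => b ξ * (𝓕 g : Lp ℂ 2 (volume : Measure ℝ)) ξ) :=
      hb.integrable_mul hg
    have i2 : Integrable (fun ξ : ℝ => ξ • (b ξ * (𝓕 g : Lp ℂ 2 (volume : Measure ℝ)) ξ)) := by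
      refine (hb1.integrable_mul hg).congr (Filter.Eventually.of_forall fun ξ => ?_)
      simp [hbdef, mul_assoc]
    convert hasDerivAt_fourierInv i1 i2 x using 3
    ring
  · intro g
    rw [fourierSynthesis_apply]
    exact tendsto_fourierInv_cocompact _
  · intro f hf g hc hg x
    rw [eq_fourierInv_of_fourier_eq hf hc _ (fourier_eq_of_besselPotential (by linarith) hg),
      fourierSynthesis_apply]
    apply Real.fourierInv_congr_ae
    filter_upwards [Lp.coeFn_lpSMul (r := 1) (hb.toLp b) (𝓕 g : Lp ℂ 2 (volume : Measure ℝ)),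
      hb.coeFn_toLp] with ξ h1 h2
    rw [h1]
    simp [h2]

/-! ### Pointwise regularity of curves in `H^m` -/

/-- `f t x` is of class `C¹` in space and differentiable in time on `[0,T] × ℝ`, with `f` and `f_x`
bounded by `C` and `C`-Lipschitz in time, and `f t` vanishes at infinity. -/
structure BoundedC1 (T C : ℝ) (f : ℝ → ℝ → ℝ) : Prop where
  diff_x : ∀ t ∈ Icc (0 : ℝ) T, Differentiable ℝ (f t)
  abs_le : ∀ t ∈ Icc (0 : ℝ) T, ∀ x, |f t x| ≤ C
  abs_deriv_le : ∀ t ∈ Icc (0 : ℝ) T, ∀ x, |deriv (f t) x| ≤ C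
  lip : ∀ s ∈ Icc (0 : ℝ) T, ∀ t ∈ Icc (0 : ℝ) T, ∀ x, |f t x - f s x| ≤ C * |t - s|
  lip_deriv : ∀ s ∈ Icc (0 : ℝ) T, ∀ t ∈ Icc (0 : ℝ) T, ∀ x,
    |deriv (f t) x - deriv (f s) x| ≤ C * |t - s|
  cont_deriv : ∀ t ∈ Icc (0 : ℝ) T, Continuous (deriv (f t))
  diff_t : ∀ t ∈ Ioo (0 : ℝ) T, ∀ x, DifferentiableAt ℝ (fun s => f s x) t
  vanish : ∀ t ∈ Icc (0 : ℝ) T, Filter.Tendsto (f t) (Filter.cocompact ℝ) (nhds 0)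

theorem BoundedC1.mono {T C C' : ℝ} {f : ℝ → ℝ → ℝ} (h : BoundedC1 T C f) (hC : C ≤ C') :
    BoundedC1 T C' f where
  diff_x := h.diff_x
  abs_le t ht x := (h.abs_le t ht x).trans hC
  abs_deriv_le t ht x := (h.abs_deriv_le t ht x).trans hC
  lip s hs t ht x := (h.lip s hs t ht x).trans (by gcongr)
  lip_deriv s hs t ht x := (h.lip_deriv s hs t ht x).trans (by gcongr)
  cont_deriv := h.cont_deriv
  diff_t := h.diff_t
  vanish := h.vanish

/-- The embeddings `S₀` and `S₁` are bounded linear maps, so bounds and Lipschitz estimates for the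
curve `G` in `L²` pass to `f` and `f_x`, uniformly in `x`. -/
theorem IsC1Sobolev.exists_boundedC1 {m T : ℝ} (hm : 3 < 2 * m) (hT : 0 < T) {f : ℝ → ℝ → ℝ}
    (h : IsC1Sobolev m T f) : ∃ C, BoundedC1 T C f := by
  obtain ⟨S₀, S₁, hS, hS0, hS1⟩ := exists_sobolev_embedding hm
  obtain ⟨G, hG, hf⟩ := h
  have hrep : ∀ t ∈ Icc (0 : ℝ) T, ∀ x, (f t x : ℂ) = S₀ (G t) x := by
    intro t ht x
    obtain ⟨hc, hL, hb⟩ := hf t ht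
    exact hS1 _ hL (G t) (by fun_prop) hb x
  have hre : ∀ t ∈ Icc (0 : ℝ) T, f t = fun x => (S₀ (G t) x).re := by
    intro t ht
    ext x
    rw [← hrep t ht x, Complex.ofReal_re]
  have hderiv : ∀ t ∈ Icc (0 : ℝ) T, ∀ x, HasDerivAt (f t) (S₁ (G t) x).re x := by
    intro t ht x
    rw [hre t ht]
    exact (Complex.reCLM.hasFDerivAt.comp_hasDerivAt x (hS (G t) x))
  have hderiv' : ∀ t ∈ Icc (0 : ℝ) T, deriv (f t) = fun x => (S₁ (G t) x).re := by
    intro t ht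
    ext x
    exact (hderiv t ht x).deriv
  have bd : ∀ (S : Lp ℂ 2 (volume : Measure ℝ) →L[ℂ] BoundedContinuousFunction ℝ ℂ) g x,
      |(S g x).re| ≤ ‖S‖ * ‖g‖ := fun S g x =>
    (Complex.abs_re_le_norm _).trans (((S g).norm_coe_le_norm x).trans (S.le_opNorm g))
  have hGc : ContinuousOn G (Icc 0 T) := hG.continuousOn
  obtain ⟨M, hM⟩ := (isCompact_Icc (a := (0:ℝ)) (b := T)).exists_bound_of_continuousOn hGc
  obtain ⟨L, hL⟩ := hG.exists_lipschitzOnWith (by norm_num) (convex_Icc 0 T) isCompact_Icc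
  have hLn : ∀ s ∈ Icc (0 : ℝ) T, ∀ t ∈ Icc (0 : ℝ) T, ‖G t - G s‖ ≤ L * |t - s| := by
    intro s hs t ht
    have := hL.dist_le_mul t ht s hs
    rwa [dist_eq_norm, Real.dist_eq] at this
  have hM0 : 0 ≤ M := (norm_nonneg _).trans (hM 0 ⟨le_rfl, hT.le⟩)
  have aux : ∀ (S : Lp ℂ 2 (volume : Measure ℝ) →L[ℂ] BoundedContinuousFunction ℝ ℂ),
      ∀ s ∈ Icc (0 : ℝ) T, ∀ t ∈ Icc (0 : ℝ) T, ∀ x,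
      |(S (G t) x).re - (S (G s) x).re| ≤ ‖S‖ * L * |t - s| := by
    intro S s hs t ht x
    have h1 := bd S (G t - G s) x
    rw [map_sub, BoundedContinuousFunction.sub_apply, Complex.sub_re] at h1
    refine h1.trans ?_
    rw [mul_assoc]
    gcongr
    exact hLn s hs t ht
  refine ⟨(‖S₀‖ + ‖S₁‖) * (M + L), ?_, ?_, ?_, ?_, ?_, ?_, ?_, ?_⟩
  · exact fun t ht x => (hderiv t ht x).differentiableAt
  · intro t ht x
    rw [hre t ht]
    refine (bd S₀ _ x).trans ?_
    have := hM t ht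
    gcongr
    · linarith [norm_nonneg S₁]
    · linarith [L.coe_nonneg]
  · intro t ht x
    rw [hderiv' t ht]
    refine (bd S₁ _ x).trans ?_
    have := hM t ht
    gcongr
    · linarith [norm_nonneg S₀]
    · linarith [L.coe_nonneg]
  · intro s hs t ht x
    rw [hre t ht, hre s hs]
    refine (aux S₀ s hs t ht x).trans ?_
    gcongr
    · linarith [norm_nonneg S₁]
    · linarith [L.coe_nonneg]
  · intro s hs t ht x
    rw [hderiv' t ht, hderiv' s hs]
    refine (aux S₁ s hs t ht x).trans ?_
    gcongr
    · linarith [norm_nonneg S₀]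
    · linarith [L.coe_nonneg]
  · intro t ht
    rw [hderiv' t ht]
    exact Complex.continuous_re.comp (S₁ (G t)).continuous
  · intro t ht x
    have hGd : DifferentiableAt ℝ G t :=
      (hG.contDiffAt (Icc_mem_nhds ht.1 ht.2)).differentiableAt (by norm_num)
    have h2 : DifferentiableAt ℝ (fun s => (S₀ (G s) x).re) t := by
      have e : (fun s => (S₀ (G s) x).re) =
          ((Complex.reCLM ∘L ((BoundedContinuousFunction.evalCLM ℂ x).restrictScalars ℝ)) ∘L
            S₀.restrictScalars ℝ) ∘ G := by
        ext s; rfl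
      rw [e]
      exact (ContinuousLinearMap.differentiableAt _).comp t hGd
    refine h2.congr_of_eventuallyEq ?_
    filter_upwards [Icc_mem_nhds ht.1 ht.2] with s hs
    rw [hre s hs]
  · intro t ht
    rw [hre t ht]
    exact (Complex.continuous_re.tendsto' 0 0 Complex.zero_re).comp (hS0 (G t))

namespace BoundedC1

variable {T C : ℝ} {f g : ℝ → ℝ → ℝ}

theorem nonneg (h : BoundedC1 T C f) (hT : 0 ≤ T) : 0 ≤ C :=
  (abs_nonneg _).trans (h.abs_le 0 ⟨le_rfl, hT⟩ 0)

theorem continuousOn (h : BoundedC1 T C f) :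
    ContinuousOn (fun q : ℝ × ℝ => f q.1 q.2) (Icc 0 T ×ˢ univ) := by
  have := continuousOn_prod_of_continuousOn_lipschitzOnWith' (s := Icc (0:ℝ) T)
    (t := (univ : Set ℝ)) (fun q : ℝ × ℝ => f q.1 q.2) C.toNNReal ?_ ?_
  · exact this
  · intro t ht
    apply LipschitzWith.lipschitzOnWith
    apply lipschitzWith_of_nnnorm_deriv_le (h.diff_x t ht)
    intro x
    rw [← NNReal.coe_le_coe, coe_nnnorm]
    exact (h.abs_deriv_le t ht x).trans (Real.le_coe_toNNReal C)
  · intro x _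
    have : LipschitzOnWith C.toNNReal (fun s => f s x) (Icc 0 T) := by
      apply LipschitzOnWith.of_dist_le_mul
      intro t ht s hs
      rw [Real.dist_eq, Real.dist_eq]
      refine (h.lip s hs t ht x).trans ?_
      gcongr
      exact Real.le_coe_toNNReal C
    exact this.continuousOn

theorem continuousOn_deriv (h : BoundedC1 T C f) :
    ContinuousOn (fun q : ℝ × ℝ => deriv (f q.1) q.2) (Icc 0 T ×ˢ univ) := by
  have := continuousOn_prod_of_continuousOn_lipschitzOnWith (s := (Icc (0:ℝ) T))
    (t := (univ : Set ℝ)) (fun q : ℝ × ℝ => deriv (f q.1) q.2) C.toNNReal ?_ ?_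
  · exact this
  · intro t ht
    exact (h.cont_deriv t ht).continuousOn
  · intro x _
    apply LipschitzOnWith.of_dist_le_mul
    intro t ht s hs
    rw [Real.dist_eq, Real.dist_eq]
    refine (h.lip_deriv s hs t ht x).trans ?_
    gcongr
    exact Real.le_coe_toNNReal C

theorem lip_x (h : BoundedC1 T C f) {t : ℝ} (ht : t ∈ Icc (0:ℝ) T) (x y : ℝ) :
    |f t x - f t y| ≤ C * |x - y| := by
  have := Convex.norm_image_sub_le_of_norm_deriv_le (𝕜 := ℝ) (f := f t) (s := univ) (C := C)
    (fun z _ => h.diff_x t ht z) (fun z _ => h.abs_deriv_le t ht z) convex_univ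
    (mem_univ y) (mem_univ x)
  simpa [Real.norm_eq_abs] using this

theorem abs_deriv_t_le (h : BoundedC1 T C f) (hT : 0 ≤ T) {t : ℝ} (ht : t ∈ Ioo (0:ℝ) T) (x : ℝ) :
    |deriv (fun s => f s x) t| ≤ C := by
  have hC := h.nonneg hT
  have := norm_deriv_le_of_lip' (f := fun s => f s x) (x₀ := t) hC ?_
  · simpa using this
  · filter_upwards [Icc_mem_nhds ht.1 ht.2] with s hs
    exact h.lip t (Ioo_subset_Icc_self ht) s hs x

/-- Chain rule along a curve. -/
theorem hasDerivAt_comp (h : BoundedC1 T C f) {A : ℝ → ℝ} {a t : ℝ} (ht : t ∈ Ioo (0:ℝ) T)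
    (hA : HasDerivAt A a t) :
    HasDerivAt (fun s => f s (A s))
      (deriv (fun s => f s (A t)) t + deriv (f t) (A t) * a) t := by
  have h1 : HasDerivAt (fun s => f s (A t)) (deriv (fun s => f s (A t)) t) t :=
    (h.diff_t t ht (A t)).hasDerivAt
  have h2 : HasDerivAt (fun s => f t (A s)) (deriv (f t) (A t) * a) t :=
    ((h.diff_x t (Ioo_subset_Icc_self ht) (A t)).hasDerivAt).comp t hA
  -- The mixed second difference is at most `C |s - t| |A s - A t|`, since `f_x` is Lipschitz in
  -- time, hence `o(s - t)`. Joint differentiability of `f` is thereby avoided.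
  have h3 : HasDerivAt (fun s => (f s (A s) - f s (A t)) - (f t (A s) - f t (A t))) 0 t := by
    rw [hasDerivAt_iff_isLittleO]
    have hO : (fun s => (f s (A s) - f s (A t)) - (f t (A s) - f t (A t))) =O[nhds t]
        (fun s => (s - t) * (A s - A t)) := by
      apply Asymptotics.IsBigO.of_bound C
      filter_upwards [Icc_mem_nhds ht.1 ht.2] with s hs
      have htI := Ioo_subset_Icc_self ht
      have := Convex.norm_image_sub_le_of_norm_deriv_le (𝕜 := ℝ) (f := fun y => f s y - f t y)
        (s := univ) (C := C * |s - t|)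
        (fun z _ => (h.diff_x s hs z).sub (h.diff_x t htI z)) (fun z _ => by
          rw [deriv_fun_sub (h.diff_x s hs z) (h.diff_x t htI z)]
          exact h.lip_deriv t htI s hs z) convex_univ
        (mem_univ (A t)) (mem_univ (A s))
      simp only [Real.norm_eq_abs] at this ⊢
      rw [abs_mul, ← mul_assoc]
      refine le_trans (le_of_eq ?_) this
      congr 1
      ring
    have ho : (fun s => (s - t) * (A s - A t)) =o[nhds t] (fun s => s - t) := by
      have : (fun s => A s - A t) =o[nhds t] (fun _ => (1:ℝ)) := by
        rw [Asymptotics.isLittleO_one_iff]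
        exact tendsto_sub_nhds_zero_iff.2 hA.continuousAt.tendsto
      simpa using (Asymptotics.isBigO_refl (fun s => s - t) (nhds t)).mul_isLittleO this
    have := hO.trans_isLittleO ho
    simpa using this
  have h4 := (h3.add h1).add h2
  have h5 := h4.sub (hasDerivAt_const t (f t (A t)))
  refine (h5.congr_deriv (by ring)).congr_of_eventuallyEq (Filter.Eventually.of_forall fun s => ?_)
  simp only [Pi.add_apply, Pi.sub_apply]
  ring

end BoundedC1

/-! ### Integral curves and transport of the densities -/

/-- `A` is an integral curve of the velocity field `v` on `[0,T]`. -/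
def IsPath (T : ℝ) (v : ℝ → ℝ → ℝ) (A : ℝ → ℝ) : Prop :=
  ∀ s ∈ Icc (0 : ℝ) T, HasDerivWithinAt A (v s (A s)) (Icc 0 T) s

namespace IsPath

variable {T C : ℝ} {v : ℝ → ℝ → ℝ} {A : ℝ → ℝ}

theorem continuousOn (h : IsPath T v A) : ContinuousOn A (Icc 0 T) :=
  fun s hs => (h s hs).continuousWithinAt

theorem hasDerivAt (h : IsPath T v A) {s : ℝ} (hs : s ∈ Ioo 0 T) : HasDerivAt A (v s (A s)) s :=
  (h s (Ioo_subset_Icc_self hs)).hasDerivAt (Icc_mem_nhds hs.1 hs.2)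

theorem abs_sub_le (h : IsPath T v A) (hv : BoundedC1 T C v) {s t : ℝ} (hs : s ∈ Icc 0 T)
    (ht : t ∈ Icc 0 T) : |A t - A s| ≤ C * |t - s| := by
  have := Convex.norm_image_sub_le_of_norm_hasDerivWithin_le (𝕜 := ℝ) (f := A) (s := Icc 0 T)
    (C := C) h (fun s hs => by simpa using hv.abs_le s hs (A s)) (convex_Icc 0 T) hs ht
  simpa [Real.norm_eq_abs] using this

theorem continuousOn_comp (h : IsPath T v A) {g : ℝ × ℝ → ℝ}
    (hg : ContinuousOn g (Icc 0 T ×ˢ univ)) : ContinuousOn (fun s => g (s, A s)) (Icc 0 T) :=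
  hg.comp (continuousOn_id.prodMk h.continuousOn) fun _ hs => ⟨hs, mem_univ _⟩

end IsPath

/-- Picard–Lindelöf on a ball of radius `C T`: as `|v| ≤ C`, no curve leaves it, so the solution
covers all of `[0,T]`. -/
theorem BoundedC1.exists_path {T C : ℝ} {v : ℝ → ℝ → ℝ} (hv : BoundedC1 T C v) {t : ℝ}
    (ht : t ∈ Icc 0 T) (x : ℝ) : ∃ A, A t = x ∧ IsPath T v A := by
  have hT : 0 ≤ T := ht.1.trans ht.2
  have hC := hv.nonneg hT
  have hPL : IsPicardLindelof v (⟨t, ht⟩ : Icc (0:ℝ) T) x (C.toNNReal * T.toNNReal) 0 C.toNNReal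
      C.toNNReal := by
    refine ⟨?_, ?_, ?_, ?_⟩
    · intro s hs
      apply LipschitzOnWith.of_dist_le_mul
      intro y _ z _
      rw [Real.dist_eq, Real.dist_eq, Real.coe_toNNReal _ hC]
      exact hv.lip_x hs y z
    · intro y _
      exact hv.continuousOn.comp (continuousOn_id.prodMk continuousOn_const)
        fun s hs => ⟨hs, mem_univ _⟩
    · intro s hs y _
      rw [Real.coe_toNNReal _ hC]
      exact hv.abs_le s hs y
    · simp only [NNReal.coe_mul, Real.coe_toNNReal _ hC, Real.coe_toNNReal _ hT, NNReal.coe_zero,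
        sub_zero]
      gcongr
      simp only [sup_le_iff]
      constructor <;> linarith [ht.1, ht.2]
  obtain ⟨A, h1, h2⟩ := hPL.exists_eq_forall_mem_Icc_hasDerivWithinAt₀
  exact ⟨A, h1, h2⟩

theorem eq_of_hasDerivAt_zero {F : ℝ → ℝ} {T t : ℝ} (hF : ContinuousOn F (Icc 0 T))
    (h : ∀ s ∈ Ioo 0 T, HasDerivAt F 0 s) (ht : t ∈ Icc 0 T) : F t = F 0 := by
  rcases eq_or_lt_of_le ht.1 with h0 | h0
  · rw [h0]
  obtain ⟨c, -, hc⟩ := exists_hasDerivAt_eq_slope F (fun _ => 0) h0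
    (hF.mono (Icc_subset_Icc_right ht.2)) fun s hs => h s ⟨hs.1, hs.2.trans_le ht.2⟩
  rw [eq_comm, div_eq_zero_iff] at hc
  rcases hc with hc | hc <;> linarith

/-- The density along an integral curve of the velocity. -/
theorem transport_formula {T C C' : ℝ} {f v : ℝ → ℝ → ℝ} {A : ℝ → ℝ} (hf : BoundedC1 T C f)
    (hv : BoundedC1 T C' v)
    (h : ∀ t ∈ Ioo (0 : ℝ) T, ∀ x,
      deriv (fun s => f s x) t + v t x * deriv (f t) x + f t x * deriv (v t) x = 0)
    (hA : IsPath T v A) {t : ℝ} (ht : t ∈ Icc 0 T) :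
    f t (A t) = f 0 (A 0) * Real.exp (-∫ s in (0:ℝ)..t, deriv (v s) (A s)) := by
  set q : ℝ → ℝ := fun s => deriv (v s) (A s) with hq
  have hqc : ContinuousOn q (Icc 0 T) := hA.continuousOn_comp hv.continuousOn_deriv
  have hT : 0 ≤ T := ht.1.trans ht.2
  set J : ℝ → ℝ := fun t => ∫ s in (0:ℝ)..t, q s with hJ
  have hqi : IntervalIntegrable q volume 0 T := hqc.intervalIntegrable_of_Icc hT
  have hJc : ContinuousOn J (Icc 0 T) := by
    have := intervalIntegral.continuousOn_primitive_interval' hqi left_mem_uIcc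
    rwa [uIcc_of_le hT] at this
  have hJd : ∀ s ∈ Ioo 0 T, HasDerivAt J (q s) s := by
    intro s hs
    have hn : Icc 0 T ∈ nhds s := Icc_mem_nhds hs.1 hs.2
    exact intervalIntegral.integral_hasDerivAt_right
      ((hqc.mono (Icc_subset_Icc_right hs.2.le)).intervalIntegrable_of_Icc hs.1.le)
      (hqc.stronglyMeasurableAtFilter_nhdsWithin measurableSet_Icc s |>.filter_mono
        (by rw [nhdsWithin_eq_nhds.2 hn])) (hqc.continuousAt hn)
  have hFc : ContinuousOn (fun s => f s (A s) * Real.exp (J s)) (Icc 0 T) :=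
    (hA.continuousOn_comp hf.continuousOn).mul hJc.rexp
  have := eq_of_hasDerivAt_zero hFc (fun s hs => by
    refine ((hf.hasDerivAt_comp hs (hA.hasDerivAt hs)).mul (hJd s hs).exp).congr_deriv ?_
    have := h s hs (A s)
    simp only [hq]
    linear_combination Real.exp (J s) * this) ht
  have hJ0 : J 0 = 0 := by simp [hJ]
  simp only [hJ0, Real.exp_zero, mul_one] at this
  rw [← this, mul_assoc, ← Real.exp_add]
  simp [hJ]

theorem abs_integral_deriv_le {T C : ℝ} {v : ℝ → ℝ → ℝ} {A : ℝ → ℝ} (hv : BoundedC1 T C v)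
    {t : ℝ} (ht : t ∈ Icc 0 T) : |∫ s in (0:ℝ)..t, deriv (v s) (A s)| ≤ C * t := by
  have := intervalIntegral.norm_integral_le_of_norm_le_const (a := 0) (b := t) (C := C)
    (f := fun s => deriv (v s) (A s)) (by
      intro s hs
      rw [uIoc_of_le ht.1] at hs
      exact hv.abs_deriv_le s ⟨hs.1.le, hs.2.trans ht.2⟩ _)
  simpa [abs_of_nonneg ht.1] using this

/-! ### Classical form of the system and its reflection -/

/-- Classical form of the two-phase system, with all the quantities bounded by `C`. The viscous term
is written as `a w_xx + β n_x w_x`. -/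
structure TwoPhaseFlow (T C γ : ℝ) (ρ u n w : ℝ → ℝ → ℝ) : Prop where
  one_le : 1 ≤ C
  reg_ρ : BoundedC1 T C ρ
  reg_u : BoundedC1 T C u
  reg_n : BoundedC1 T C n
  reg_w : BoundedC1 T C w
  mass_ρ : ∀ t ∈ Ioo (0 : ℝ) T, ∀ x,
    deriv (fun s => ρ s x) t + u t x * deriv (ρ t) x + ρ t x * deriv (u t) x = 0
  mass_n : ∀ t ∈ Ioo (0 : ℝ) T, ∀ x,
    deriv (fun s => n s x) t + w t x * deriv (n t) x + n t x * deriv (w t) x = 0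
  momentum_u : ∀ t ∈ Ioo (0 : ℝ) T, ∀ x,
    ρ t x * (deriv (fun s => u s x) t + u t x * deriv (u t) x + (u t x - w t x)) = 0
  n_nonneg : ∀ t ∈ Icc (0 : ℝ) T, ∀ x, 0 ≤ n t x
  diff_deriv_w : ∀ t ∈ Ioo (0 : ℝ) T, Differentiable ℝ (deriv (w t))
  momentum_w : ∀ t ∈ Ioo (0 : ℝ) T, ∀ x, ∃ a β, C⁻¹ ≤ a ∧ a ≤ C ∧ |β| ≤ C ∧
    n t x * (deriv (fun s => w s x) t + w t x * deriv (w t) x) =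
      a * deriv (deriv (w t)) x + β * deriv (n t) x * deriv (w t) x
        - γ * n t x ^ (γ - 1) * deriv (n t) x + ρ t x * (u t x - w t x)

theorem IsTwoPhaseSolution.exists_twoPhaseFlow {mu : ℝ → ℝ} {γ m T B : ℝ}
    {ρ₀ u₀ n₀ w₀ : ℝ → ℝ} {ρ u n w : ℝ → ℝ → ℝ}
    (h : IsTwoPhaseSolution mu γ m T ρ₀ u₀ n₀ w₀ ρ u n w) (hγ : 1 < γ) (hB : 0 < B)
    (hmu : ViscosityBounds mu B) (hT : 0 < T) (hm : 2 < m) (hn₀ : ∀ x, 0 ≤ n₀ x) :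
    ∃ C, TwoPhaseFlow T C γ ρ u n w := by
  obtain ⟨C₁, h₁⟩ := h.reg_ρ.exists_boundedC1 (by linarith) hT
  obtain ⟨C₂, h₂⟩ := h.reg_u.exists_boundedC1 (by linarith) hT
  obtain ⟨C₃, h₃⟩ := h.reg_n.exists_boundedC1 (by linarith) hT
  obtain ⟨C₄, h₄⟩ := h.reg_w.exists_boundedC1 (by linarith) hT
  have hI : ∀ {t}, t ∈ Ioo 0 T → t ∈ Icc 0 T := fun ht => Ioo_subset_Icc_self ht
  have hmuC := hmu.1.continuousOn_derivWithin (uniqueDiffOn_Ici 0) le_rfl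
  -- The hypothesis bounds `mu'` only from above; the bound on its absolute value comes from
  -- continuity on the compact range of `n`.
  obtain ⟨D, hD⟩ := (isCompact_Icc (a := (0:ℝ)) (b := C₃)).exists_bound_of_continuousOn
    (hmuC.mono Icc_subset_Ici_self)
  have mass : ∀ {C C' : ℝ} {f v : ℝ → ℝ → ℝ}, BoundedC1 T C f → BoundedC1 T C' v →
      (∀ t ∈ Ioo (0 : ℝ) T, ∀ x : ℝ,
        deriv (fun s => f s x) t + deriv (fun y => f t y * v t y) x = 0) →
      ∀ t ∈ Ioo (0 : ℝ) T, ∀ x,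
        deriv (fun s => f s x) t + v t x * deriv (f t) x + f t x * deriv (v t) x = 0 := by
    intro C C' f v hf hv h t ht x
    have e := h t ht x
    rw [deriv_fun_mul (hf.diff_x t (hI ht) x) (hv.diff_x t (hI ht) x)] at e
    linear_combination e
  have momentum : ∀ {C C' : ℝ} {f v : ℝ → ℝ → ℝ}, BoundedC1 T C f → BoundedC1 T C' v →
      (∀ t ∈ Ioo (0 : ℝ) T, ∀ x : ℝ,
        deriv (fun s => f s x) t + deriv (fun y => f t y * v t y) x = 0) →
      ∀ t ∈ Ioo (0 : ℝ) T, ∀ x,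
        deriv (fun s => f s x * v s x) t + deriv (fun y => f t y * v t y ^ 2) x =
          f t x * (deriv (fun s => v s x) t + v t x * deriv (v t) x) := by
    intro C C' f v hf hv h t ht x
    have e := mass hf hv h t ht x
    rw [deriv_fun_mul (hf.diff_t t ht x) (hv.diff_t t ht x),
      deriv_fun_mul (hf.diff_x t (hI ht) x) ((hv.diff_x t (hI ht) x).fun_pow 2),
      deriv_fun_pow (hv.diff_x t (hI ht) x)]
    push_cast
    linear_combination v t x * e
  have hn : ∀ t ∈ Icc (0 : ℝ) T, ∀ x, 0 ≤ n t x := by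
    intro t ht x
    obtain ⟨A, hAt, hA⟩ := h₄.exists_path ht x
    rw [← hAt, transport_formula h₃ h₄ (mass h₃ h₄ h.ns_mass) hA ht, h.init_n]
    exact mul_nonneg (hn₀ _) (Real.exp_pos _).le
  have hvisc : ∀ t ∈ Ioo (0 : ℝ) T, ∀ x, HasDerivAt (fun y => mu (n t y))
      (derivWithin mu (Ici 0) (n t x) * deriv (n t) x) x := by
    intro t ht x
    have h1 : HasDerivWithinAt mu (derivWithin mu (Ici 0) (n t x)) (Ici 0) (n t x) :=
      ((hmu.1.differentiableOn (by norm_num)) _ (hn t (hI ht) x)).hasDerivWithinAt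
    have h2 := (h₃.diff_x t (hI ht) x).hasDerivAt
    have := h1.comp x (h2.hasDerivWithinAt (s := univ)) (fun y _ => hn t (hI ht) y)
    rwa [hasDerivWithinAt_univ] at this
  have hpos : ∀ t ∈ Ioo (0 : ℝ) T, ∀ x, 0 < mu (n t x) := fun t ht x =>
    (inv_pos.2 hB).trans_le (hmu.2 _ (hn t (hI ht) x)).1
  -- `w_x` is the differentiable flux divided by the differentiable, positive function `mu n`.
  have hdw : ∀ t ∈ Ioo (0 : ℝ) T, Differentiable ℝ (deriv (w t)) := by
    intro t ht x
    have := (h.ns_flux t ht x).div (hvisc t ht x).differentiableAt (hpos t ht x).ne'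
    refine this.congr_of_eventuallyEq (Filter.Eventually.of_forall fun y => ?_)
    have := (hpos t ht y).ne'
    simp only [Pi.div_apply]
    field_simp
  set C := max (max (max C₁ C₂) (max C₃ C₄)) (max (max 1 B) D) with hCdef
  have c1 : C₁ ≤ C := by simp [hCdef]
  have c2 : C₂ ≤ C := by simp [hCdef]
  have c3 : C₃ ≤ C := by simp [hCdef]
  have c4 : C₄ ≤ C := by simp [hCdef]
  have c5 : 1 ≤ C := by simp [hCdef]
  have c6 : B ≤ C := by simp [hCdef]
  have c7 : D ≤ C := by simp [hCdef]
  refine ⟨C, c5, h₁.mono c1, h₂.mono c2, h₃.mono c3, h₄.mono c4, mass h₁ h₂ h.euler_mass,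
    mass h₃ h₄ h.ns_mass, ?_, hn, hdw, ?_⟩
  · intro t ht x
    have e1 := momentum h₁ h₂ h.euler_mass t ht x
    have e2 := h.euler_momentum t ht x
    linear_combination e2 - e1
  · intro t ht x
    have hb := hmu.2 _ (hn t (hI ht) x)
    refine ⟨mu (n t x), derivWithin mu (Ici 0) (n t x), ?_, hb.2.1.trans c6, ?_, ?_⟩
    · exact (inv_anti₀ hB c6).trans hb.1
    · exact (hD _ ⟨hn t (hI ht) x, (le_abs_self _).trans (h₃.abs_le t (hI ht) x)⟩).trans c7
    · have e1 := momentum h₃ h₄ h.ns_mass t ht x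
      have e2 := h.ns_momentum t ht x
      have e3 : deriv (fun y => mu (n t y) * deriv (w t) y) x =
          derivWithin mu (Ici 0) (n t x) * deriv (n t) x * deriv (w t) x +
            mu (n t x) * deriv (deriv (w t)) x := by
        rw [deriv_fun_mul (hvisc t ht x).differentiableAt (hdw t ht x), (hvisc t ht x).deriv]
      have e4 : deriv (fun y => n t y ^ γ) x = γ * n t x ^ (γ - 1) * deriv (n t) x := by
        have := ((h₃.diff_x t (hI ht) x).hasDerivAt.rpow_const (p := γ) (Or.inr hγ.le)).deriv
        rw [this]
        ring
      rw [e3, e4] at e2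
      linear_combination e2 - e1

theorem BoundedC1.reflect {T C : ℝ} {f : ℝ → ℝ → ℝ} (h : BoundedC1 T C f) :
    BoundedC1 T C (fun t x => f t (1 - x)) where
  diff_x t ht := (h.diff_x t ht).comp (by fun_prop)
  abs_le t ht x := h.abs_le t ht _
  abs_deriv_le t ht x := by
    rw [deriv_comp_const_sub (f := f t), abs_neg]; exact h.abs_deriv_le t ht _
  lip s hs t ht x := h.lip s hs t ht _
  lip_deriv s hs t ht x := by
    rw [deriv_comp_const_sub (f := f t), deriv_comp_const_sub (f := f s), neg_sub_neg, abs_sub_comm]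
    exact h.lip_deriv s hs t ht _
  cont_deriv t ht := by
    have : deriv (fun x => f t (1 - x)) = fun x => -deriv (f t) (1 - x) := by
      ext x; exact deriv_comp_const_sub (f := f t) ..
    rw [this]
    exact ((h.cont_deriv t ht).comp (by fun_prop)).neg
  diff_t t ht x := h.diff_t t ht _
  vanish t ht := (h.vanish t ht).comp (Homeomorph.subLeft (1 : ℝ)).isClosedEmbedding.tendsto_cocompact

theorem BoundedC1.neg {T C : ℝ} {f : ℝ → ℝ → ℝ} (h : BoundedC1 T C f) :
    BoundedC1 T C (fun t x => -f t x) where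
  diff_x t ht := (h.diff_x t ht).neg
  abs_le t ht x := by rw [abs_neg]; exact h.abs_le t ht _
  abs_deriv_le t ht x := by rw [deriv.fun_neg, abs_neg]; exact h.abs_deriv_le t ht _
  lip s hs t ht x := by
    rw [neg_sub_neg, abs_sub_comm]; exact h.lip s hs t ht _
  lip_deriv s hs t ht x := by
    rw [deriv.fun_neg, deriv.fun_neg, neg_sub_neg, abs_sub_comm]; exact h.lip_deriv s hs t ht _
  cont_deriv t ht := by
    have : deriv (fun x => -f t x) = fun x => -deriv (f t) x := by
      ext x; exact deriv.fun_neg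
    rw [this]
    exact (h.cont_deriv t ht).neg
  diff_t t ht x := (h.diff_t t ht _).fun_neg
  vanish t ht := by simpa using (h.vanish t ht).neg

/-- Under `x ↦ 1 - x` velocities change sign and densities do not. This exchanges the two end
points. -/
theorem TwoPhaseFlow.reflect {T C γ : ℝ} {ρ u n w : ℝ → ℝ → ℝ} (h : TwoPhaseFlow T C γ ρ u n w) :
    TwoPhaseFlow T C γ (fun t x => ρ t (1 - x)) (fun t x => -u t (1 - x))
      (fun t x => n t (1 - x)) (fun t x => -w t (1 - x)) := by
  have d1 : ∀ (f : ℝ → ℝ) x, deriv (fun y => f (1 - y)) x = -deriv f (1 - x) :=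
    fun f x => deriv_comp_const_sub ..
  have d2 : ∀ (f : ℝ → ℝ) x, deriv (fun y => -f (1 - y)) x = deriv f (1 - x) := by
    intro f x; rw [deriv.fun_neg, d1, neg_neg]
  refine ⟨h.one_le, h.reg_ρ.reflect, h.reg_u.reflect.neg, h.reg_n.reflect, h.reg_w.reflect.neg,
    ?_, ?_, ?_, ?_, ?_, ?_⟩
  · intro t ht x
    rw [d1, d2]
    linear_combination h.mass_ρ t ht (1 - x)
  · intro t ht x
    rw [d1, d2]
    linear_combination h.mass_n t ht (1 - x)
  · intro t ht x
    rw [d2, deriv.fun_neg]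
    linear_combination -h.momentum_u t ht (1 - x)
  · exact fun t ht x => h.n_nonneg t ht _
  · intro t ht
    have : deriv (fun y => -w t (1 - y)) = fun y => deriv (w t) (1 - y) := by
      ext y; exact d2 _ _
    rw [this]
    exact (h.diff_deriv_w t ht).comp (by fun_prop)
  · intro t ht x
    obtain ⟨a, β, h1, h2, h3, h4⟩ := h.momentum_w t ht (1 - x)
    refine ⟨a, β, h1, h2, h3, ?_⟩
    have : deriv (fun y => -w t (1 - y)) = fun y => deriv (w t) (1 - y) := by
      ext y; exact d2 _ _
    rw [this, d1, d1, deriv.fun_neg]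
    linear_combination -h4

/-! ### Bound on `w_xx` and rest in the vacuum -/

namespace TwoPhaseFlow

variable {T C γ : ℝ} {ρ u n w : ℝ → ℝ → ℝ}

/-- The embedding used controls only `w_x`. The bound on `w_xx` is read off the momentum equation,
in which every other term is bounded and `a ≥ C⁻¹`. -/
theorem exists_bound_deriv_deriv (h : TwoPhaseFlow T C γ ρ u n w) (hT : 0 < T) (hγ : 1 < γ) :
    ∃ W, 0 ≤ W ∧ ∀ t ∈ Ioo 0 T, ∀ x, |deriv (deriv (w t)) x| ≤ W := by
  have hC := h.one_le
  have hC0 : 0 < C := by linarith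
  refine ⟨C * (C * (C + C * C) + C * C * C + γ * C ^ (γ - 1) * C + C * (C + C)), by positivity,
    fun t ht x => ?_⟩
  have hI := Ioo_subset_Icc_self ht
  obtain ⟨a, β, h1, h2, h3, h4⟩ := h.momentum_w t ht x
  have ha : 0 < a := (inv_pos.2 hC0).trans_le h1
  have hn := h.n_nonneg t hI x
  have e : a * deriv (deriv (w t)) x =
      n t x * (deriv (fun s => w s x) t + w t x * deriv (w t) x) -
      β * deriv (n t) x * deriv (w t) x + γ * n t x ^ (γ - 1) * deriv (n t) x +
      ρ t x * (w t x - u t x) := by linear_combination -h4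
  have b1 := h.reg_n.abs_le t hI x
  have b2 := h.reg_w.abs_deriv_t_le hT.le ht x
  have b3 := h.reg_w.abs_le t hI x
  have b4 := h.reg_w.abs_deriv_le t hI x
  have b5 := h.reg_n.abs_deriv_le t hI x
  have b6 := h.reg_ρ.abs_le t hI x
  have b7 := h.reg_u.abs_le t hI x
  have b8 : |n t x ^ (γ - 1)| ≤ C ^ (γ - 1) := by
    rw [abs_of_nonneg (by positivity)]
    exact Real.rpow_le_rpow hn ((le_abs_self _).trans b1) (by linarith)
  have key : |a * deriv (deriv (w t)) x| ≤
      C * (C + C * C) + C * C * C + γ * C ^ (γ - 1) * C + C * (C + C) := by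
    rw [e]
    refine (abs_add_le _ _).trans (add_le_add ((abs_add_le _ _).trans
      (add_le_add ((abs_sub _ _).trans (add_le_add ?_ ?_)) ?_)) ?_)
    · rw [abs_mul]
      gcongr
      refine (abs_add_le _ _).trans ?_
      rw [abs_mul]
      gcongr
    · rw [abs_mul, abs_mul]
      gcongr
    · rw [abs_mul, abs_mul, abs_of_pos (by linarith : 0 < γ)]
      gcongr
    · rw [abs_mul]
      gcongr
      refine (abs_sub _ _).trans ?_
      gcongr
  rw [abs_mul, abs_of_pos ha] at key
  have : C⁻¹ * |deriv (deriv (w t)) x| ≤ _ := (mul_le_mul_of_nonneg_right h1 (abs_nonneg _)).trans key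
  rwa [inv_mul_le_iff₀ hC0] at this

theorem lip_deriv_w (h : TwoPhaseFlow T C γ ρ u n w) {W : ℝ}
    (hW : ∀ t ∈ Ioo 0 T, ∀ x, |deriv (deriv (w t)) x| ≤ W) {t : ℝ} (ht : t ∈ Ioo 0 T) (x y : ℝ) :
    |deriv (w t) x - deriv (w t) y| ≤ W * |x - y| := by
  have := Convex.norm_image_sub_le_of_norm_deriv_le (𝕜 := ℝ) (f := deriv (w t)) (s := univ) (C := W)
    (fun z _ => h.diff_deriv_w t ht z) (fun z _ => hW t ht z) convex_univ
    (mem_univ y) (mem_univ x)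
  simpa [Real.norm_eq_abs] using this

/-- The region reached by the vacuum is at rest. -/
theorem w_eq_zero (h : TwoPhaseFlow T C γ ρ u n w) (hρ : ∀ x ≤ 0, ρ 0 x = 0)
    (hn : ∀ x ≤ 0, n 0 x = 0) {t : ℝ} (ht : t ∈ Ioo 0 T) {x : ℝ} (hx : x < -(C * t)) :
    w t x = 0 := by
  have hC := h.one_le
  have hI := Ioo_subset_Icc_self ht
  have hT : 0 < T := ht.1.trans ht.2
  have h0 : (0:ℝ) ∈ Icc 0 T := ⟨le_rfl, hT.le⟩
  have zero : ∀ {f v : ℝ → ℝ → ℝ}, BoundedC1 T C f → BoundedC1 T C v →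
      (∀ t ∈ Ioo (0 : ℝ) T, ∀ x,
        deriv (fun s => f s x) t + v t x * deriv (f t) x + f t x * deriv (v t) x = 0) →
      (∀ x ≤ 0, f 0 x = 0) → ∀ y < -(C * t), f t y = 0 := by
    intro f v hf hv hm hz y hy
    obtain ⟨A, hAt, hA⟩ := hv.exists_path hI y
    have := hA.abs_sub_le hv hI h0
    rw [hAt, zero_sub, abs_neg, abs_of_pos ht.1] at this
    rw [← hAt, transport_formula hf hv hm hA hI, hz _ (by linarith [le_abs_self (A 0 - y)]),
      zero_mul]
  have zn := zero h.reg_n h.reg_w h.mass_n hn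
  have zρ := zero h.reg_ρ h.reg_u h.mass_ρ hρ
  -- With both densities and `n_x` zero, only the viscous term `a w_xx` survives.
  have hwxx : ∀ y ∈ Iio (-(C * t)), deriv (deriv (w t)) y = 0 := by
    intro y hy
    obtain ⟨a, β, h1, -, -, h4⟩ := h.momentum_w t ht y
    have ha : 0 < a := (inv_pos.2 (by linarith)).trans_le h1
    have hnx : deriv (n t) y = 0 := by
      have : n t =ᶠ[nhds y] fun _ => 0 := by
        filter_upwards [Iio_mem_nhds hy] with z hz using zn z hz
      rw [this.deriv_eq, deriv_const]
    rw [zn y hy, zρ y hy, hnx] at h4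
    have : a * deriv (deriv (w t)) y = 0 := by linear_combination -h4
    exact (mul_eq_zero.1 this).resolve_left ha.ne'
  have hcv : Convex ℝ (Iio (-(C * t))) := convex_Iio _
  have hc1 : ∀ y ∈ Iio (-(C * t)), deriv (w t) y = deriv (w t) x := by
    intro y hy
    have := hcv.norm_image_sub_le_of_norm_deriv_le (𝕜 := ℝ) (f := deriv (w t)) (C := 0)
      (fun z _ => h.diff_deriv_w t ht z) (fun z hz => by rw [hwxx z hz, norm_zero]) hx hy
    rw [zero_mul, norm_le_zero_iff] at this
    linarith
  have hlin : ∀ y ∈ Iio (-(C * t)), w t y = w t x + deriv (w t) x * (y - x) := by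
    intro y hy
    have hd : ∀ z, DifferentiableAt ℝ (fun z => w t z - deriv (w t) x * z) z := fun z =>
      (h.reg_w.diff_x t hI z).sub (by fun_prop)
    have := hcv.norm_image_sub_le_of_norm_deriv_le (𝕜 := ℝ)
      (f := fun z => w t z - deriv (w t) x * z) (C := 0)
      (fun z _ => hd z) (fun z hz => by
        rw [deriv_fun_sub (h.reg_w.diff_x t hI z) (by fun_prop), hc1 z hz, deriv_const_mul _ (by fun_prop)]
        simp) hx hy
    rw [zero_mul, norm_le_zero_iff] at this
    linarith
  have hlim : Filter.Tendsto (w t) Filter.atBot (nhds 0) :=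
    (h.reg_w.vanish t hI).mono_left (by rw [cocompact_eq_atBot_atTop]; exact le_sup_left)
  set c := deriv (w t) x with hc
  -- The constant increment `w t y - w t (y - 1) = c` tends to `0` at `-∞`.
  have hc0 : c = 0 := by
    have l1 : Filter.Tendsto (fun y => w t (y - 1)) Filter.atBot (nhds 0) :=
      hlim.comp (Filter.tendsto_atBot_add_const_right _ (-1) Filter.tendsto_id)
    have l2 := hlim.sub l1
    rw [sub_zero] at l2
    refine tendsto_nhds_unique (Filter.Tendsto.congr' ?_ tendsto_const_nhds) l2
    filter_upwards [Filter.eventually_lt_atBot (-(C * t))] with y hy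
    rw [hlin y hy, hlin (y - 1) (by simp only [mem_Iio]; linarith)]
    ring
  refine (tendsto_nhds_unique (Filter.Tendsto.congr' ?_ hlim) tendsto_const_nhds).symm
  filter_upwards [Filter.eventually_lt_atBot (-(C * t))] with y hy
  rw [hlin y hy, hc0]
  ring

/-- The equations hold only at positive times. The value at time `0` is the limit of `w s (x - 2 * C
* s) = 0` as `s → 0`, using the Lipschitz bounds. -/
theorem w_zero_eq_zero (h : TwoPhaseFlow T C γ ρ u n w) (hT : 0 < T)
    (hρ : ∀ x ≤ 0, ρ 0 x = 0) (hn : ∀ x ≤ 0, n 0 x = 0) {x : ℝ} (hx : x ≤ 0) : w 0 x = 0 := by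
  have hC := h.one_le
  have h0 : (0:ℝ) ∈ Icc 0 T := ⟨le_rfl, hT.le⟩
  have key : ∀ s ∈ Ioo 0 T, |w 0 x| ≤ C * s + C * (2 * C * s) := by
    intro s hs
    have z := h.w_eq_zero hρ hn hs (x := x - 2 * C * s) (by nlinarith [hs.1])
    have l1 := h.reg_w.lip s (Ioo_subset_Icc_self hs) 0 h0 x
    have l2 := h.reg_w.lip_x (Ioo_subset_Icc_self hs) x (x - 2 * C * s)
    have hs1 : 0 < 2 * C * s := by have := hs.1; positivity
    rw [zero_sub, abs_neg, abs_of_pos hs.1] at l1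
    rw [z, sub_zero, show x - (x - 2 * C * s) = 2 * C * s by ring, abs_of_pos hs1] at l2
    have := abs_sub_abs_le_abs_sub (w 0 x) (w s x)
    linarith
  have lim : Filter.Tendsto (fun s => C * s + C * (2 * C * s)) (nhdsWithin 0 (Ioi 0)) (nhds 0) := by
    have : Continuous fun s => C * s + C * (2 * C * s) := by fun_prop
    exact (this.tendsto' 0 0 (by simp)).mono_left nhdsWithin_le_nhds
  have := ge_of_tendsto lim (by
    filter_upwards [Ioo_mem_nhdsGT hT] with s hs using key s hs)
  exact abs_nonpos_iff.1 this

end TwoPhaseFlow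

/-! ### Maximum principle and the initial push by the pressure -/

/-- Either `f` stays negative, or there is a first time at which it vanishes in the interior. -/
theorem forall_neg_or_exists_first_zero {f : ℝ → ℝ → ℝ} {t₀ t₁ α β : ℝ}
    (hf : ContinuousOn (fun q : ℝ × ℝ => f q.1 q.2) (Icc t₀ t₁ ×ˢ Icc α β))
    (hbot : ∀ x ∈ Icc α β, f t₀ x < 0) (hleft : ∀ t ∈ Icc t₀ t₁, f t α < 0)
    (hright : ∀ t ∈ Icc t₀ t₁, f t β < 0) :
    (∀ t ∈ Icc t₀ t₁, ∀ x ∈ Icc α β, f t x < 0) ∨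
      ∃ t ∈ Ioc t₀ t₁, ∃ x ∈ Ioo α β, f t x = 0 ∧ ∀ s ∈ Icc t₀ t, ∀ y ∈ Icc α β, f s y ≤ 0 := by
  by_contra! hcon
  obtain ⟨⟨t', ht', x', hx', hf'⟩, hcon⟩ := hcon
  set K := {q ∈ Icc t₀ t₁ ×ˢ Icc α β | f q.1 q.2 ∈ Ici 0} with hK
  have hKc : IsCompact K := (isCompact_Icc.prod isCompact_Icc).of_isClosed_subset
    (hf.preimage_isClosed_of_isClosed (isClosed_Icc.prod isClosed_Icc) isClosed_Ici)
    (fun q hq => hq.1)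
  -- The first contact minimises time over the compact set where `f ≥ 0`.
  obtain ⟨⟨t, x⟩, ⟨⟨ht, hx⟩, h0⟩, hmin⟩ := hKc.exists_isMinOn ⟨(t', x'), ⟨ht', hx'⟩, hf'⟩
    continuous_fst.continuousOn
  simp only [mem_Ici] at h0 ht hx
  have hlt : ∀ s ∈ Icc t₀ t₁, s < t → ∀ y ∈ Icc α β, f s y < 0 := by
    intro s hs hst y hy
    by_contra! hc
    exact absurd (hmin (a := (s, y)) ⟨⟨hs, hy⟩, hc⟩) (not_le.2 hst)
  have htt : t₀ < t := by
    rcases eq_or_lt_of_le ht.1 with e | e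
    · rw [← e] at h0; exact absurd (hbot x hx) (not_lt.2 h0)
    · exact e
  have hle : ∀ y ∈ Icc α β, f t y ≤ 0 := by
    intro y hy
    have hc : ContinuousWithinAt (fun s => f s y) (Icc t₀ t₁) t :=
      (hf.comp (f := fun s : ℝ => (s, y)) (by fun_prop) fun s hs => ⟨hs, hy⟩) t ht
    have hc2 := (hc.mono (Ioo_subset_Icc_self.trans (Icc_subset_Icc_right ht.2) : Ioo t₀ t ⊆ _))
    have : (nhdsWithin t (Ioo t₀ t)).NeBot := right_nhdsWithin_Ioo_neBot htt
    refine le_of_tendsto hc2 ?_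
    filter_upwards [self_mem_nhdsWithin] with s hs
    exact (hlt s ⟨hs.1.le, hs.2.le.trans ht.2⟩ hs.2 y hy).le
  have hxα : α < x := by
    rcases eq_or_lt_of_le hx.1 with e | e
    · rw [← e] at h0; exact absurd (hleft t ht) (not_lt.2 h0)
    · exact e
  have hxβ : x < β := by
    rcases eq_or_lt_of_le hx.2 with e | e
    · rw [e] at h0; exact absurd (hright t ht) (not_lt.2 h0)
    · exact e
  obtain ⟨s, hs, y, hy, hsy⟩ := hcon t ⟨htt, ht.2⟩ x ⟨hxα, hxβ⟩ (le_antisymm (hle x hx) h0)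
  rcases eq_or_lt_of_le hs.2 with e | e
  · rw [e] at hsy; exact absurd (hle y hy) (not_le.2 hsy)
  · exact absurd (hlt s ⟨hs.1, hs.2.trans ht.2⟩ e y hy) (not_lt.2 hsy.le)

theorem nonneg_of_hasDerivAt_of_nonpos_left {g : ℝ → ℝ} {g' t t₀ : ℝ} (hg : HasDerivAt g g' t)
    (ht : t₀ < t) (h0 : g t = 0) (h : ∀ s ∈ Ioo t₀ t, g s ≤ 0) : 0 ≤ g' := by
  have h1 : Filter.Tendsto (slope g t) (nhdsWithin t (Iio t)) (nhds g') :=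
    (hasDerivAt_iff_tendsto_slope.1 hg).mono_left (nhdsWithin_mono _ fun s hs => ne_of_lt hs)
  refine ge_of_tendsto h1 ?_
  filter_upwards [Ioo_mem_nhdsLT ht] with s hs
  rw [slope_def_field, h0, sub_zero]
  exact div_nonneg_of_nonpos (h s hs) (by linarith [hs.2])

/-- A positive second derivative would make `x` a local minimum too, so `g` would be locally
constant and the second derivative zero. -/
theorem deriv_deriv_nonpos_of_isLocalMax {g : ℝ → ℝ} {x : ℝ} (hg : ContinuousAt g x)
    (h : IsLocalMax g x) : deriv (deriv g) x ≤ 0 := by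
  by_contra! hpos
  have hmin := isLocalMin_of_deriv_deriv_pos hpos h.deriv_eq_zero hg
  have hconst : g =ᶠ[nhds x] fun _ => g x := by
    filter_upwards [h, hmin] with y h1 h2 using le_antisymm h1 h2
  have : deriv g =ᶠ[nhds x] fun _ => 0 := by
    simpa using hconst.deriv
  rw [this.deriv_eq, deriv_const] at hpos
  exact lt_irrefl _ hpos

namespace TwoPhaseFlow

variable {T C γ : ℝ} {ρ u n w : ℝ → ℝ → ℝ}

/-- Comparison of `w` with a barrier `ψ`: at a first contact point the derivatives of `w` and `ψ`
are ordered, and the momentum equation gives an inequality for `ψ`. -/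
theorem lt_barrier (h : TwoPhaseFlow T C γ ρ u n w) {ψ ψt ψx ψxx : ℝ → ℝ → ℝ} {t₀ t₁ α β : ℝ}
    (ht₀ : 0 ≤ t₀) (ht₁ : t₁ < T) (hψ : Continuous fun q : ℝ × ℝ => ψ q.1 q.2)
    (hψt : ∀ t x, HasDerivAt (fun s => ψ s x) (ψt t x) t)
    (hψx : ∀ t x, HasDerivAt (ψ t) (ψx t x) x)
    (hψxx : ∀ t x, HasDerivAt (ψx t) (ψxx t x) x)
    (hbot : ∀ x ∈ Icc α β, w t₀ x < ψ t₀ x) (hleft : ∀ t ∈ Icc t₀ t₁, w t α < ψ t α)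
    (hright : ∀ t ∈ Icc t₀ t₁, w t β < ψ t β)
    (hno : ∀ t ∈ Ioc t₀ t₁, ∀ x ∈ Ioo α β, ∀ a b, w t x = ψ t x →
      (∀ s ∈ Icc t₀ t, ∀ y ∈ Icc α β, w s y ≤ ψ s y) → C⁻¹ ≤ a → a ≤ C → |b| ≤ C →
      n t x * (ψt t x + ψ t x * ψx t x) ≤ a * ψxx t x + b * deriv (n t) x * ψx t x
        - γ * n t x ^ (γ - 1) * deriv (n t) x + ρ t x * (u t x - ψ t x) → False) :
    ∀ t ∈ Icc t₀ t₁, ∀ x ∈ Icc α β, w t x < ψ t x := by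
  have hsub : Icc t₀ t₁ ⊆ Icc 0 T := Icc_subset_Icc ht₀ ht₁.le
  rcases forall_neg_or_exists_first_zero (f := fun t x => w t x - ψ t x) (t₀ := t₀) (t₁ := t₁)
    (α := α) (β := β)
    ((h.reg_w.continuousOn.mono (prod_mono hsub (subset_univ _))).sub hψ.continuousOn)
    (fun x hx => sub_neg.2 (hbot x hx)) (fun t ht => sub_neg.2 (hleft t ht))
    (fun t ht => sub_neg.2 (hright t ht)) with hneg | ⟨t, ht, x, hx, h0, hle⟩
  · exact fun t ht x hx => sub_neg.1 (hneg t ht x hx)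
  exfalso
  have htT : t ∈ Ioo 0 T := ⟨ht₀.trans_lt ht.1, ht.2.trans_lt ht₁⟩
  have hI := Ioo_subset_Icc_self htT
  have heq : w t x = ψ t x := sub_eq_zero.1 h0
  have d1 : ψt t x ≤ deriv (fun s => w s x) t := by
    have := nonneg_of_hasDerivAt_of_nonpos_left
      ((h.reg_w.diff_t t htT x).hasDerivAt.sub (hψt t x)) ht.1 h0
      (fun s hs => hle s ⟨hs.1.le, hs.2.le⟩ x (Ioo_subset_Icc_self hx))
    linarith
  have hmax : IsLocalMax (fun y => w t y - ψ t y) x := by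
    filter_upwards [Icc_mem_nhds hx.1 hx.2] with y hy
    rw [h0]
    exact hle t ⟨ht.1.le, le_rfl⟩ y hy
  have hd : ∀ y, HasDerivAt (fun y => w t y - ψ t y) (deriv (w t) y - ψx t y) y := fun y =>
    (h.reg_w.diff_x t hI y).hasDerivAt.sub (hψx t y)
  have d2 : deriv (w t) x = ψx t x := by
    have := hmax.hasDerivAt_eq_zero (hd x)
    linarith
  have d3 : deriv (deriv (w t)) x ≤ ψxx t x := by
    have := deriv_deriv_nonpos_of_isLocalMax (hd x).continuousAt hmax
    have e : deriv (fun y => w t y - ψ t y) = fun y => deriv (w t) y - ψx t y := by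
      ext y; exact (hd y).deriv
    rw [e, ((h.diff_deriv_w t htT x).hasDerivAt.fun_sub (hψxx t x)).deriv] at this
    linarith
  obtain ⟨a, b, h1, h2, h3, h4⟩ := h.momentum_w t htT x
  have hC := h.one_le
  have ha : 0 < a := (inv_pos.2 (by linarith)).trans_le h1
  refine hno t ht x hx a b heq (fun s hs y hy => sub_nonpos.1 (hle s hs y hy)) h1 h2 h3 ?_
  rw [d2, heq] at h4
  have m1 := mul_le_mul_of_nonneg_left d1 (h.n_nonneg t hI x)
  have m2 := mul_le_mul_of_nonneg_left d3 ha.le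
  linarith

/-- Where the pressure gradient dominates the drag, and `w` is initially nonpositive, `w` becomes
negative at a linear rate. -/
theorem exists_push (h : TwoPhaseFlow T C γ ρ u n w) (hT : 0 < T) (hγ : 1 < γ) {x₀ r : ℝ}
    (hr : 0 < r) (hw : ∀ x ∈ Icc (x₀ - r) (x₀ + r), w 0 x ≤ 0)
    (hsrc : ρ 0 x₀ * (u 0 x₀ - w 0 x₀) < γ * n 0 x₀ ^ (γ - 1) * deriv (n 0) x₀) :
    ∃ ε > 0, ∃ τ > 0, ∃ δ > 0, δ ≤ r ∧ τ < T ∧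
      ∀ z ∈ Icc (x₀ - δ) (x₀ + δ), ∀ t ∈ Icc 0 τ, w t z ≤ -(ε * t) := by
  have hC := h.one_le
  have h0 : (0:ℝ) ∈ Icc 0 T := ⟨le_rfl, hT.le⟩
  set H : ℝ × ℝ → ℝ := fun q => ρ q.1 q.2 * (u q.1 q.2 - w q.1 q.2) -
    γ * n q.1 q.2 ^ (γ - 1) * deriv (n q.1) q.2 with hH
  have hHc : ContinuousOn H (Icc 0 T ×ˢ univ) :=
    (h.reg_ρ.continuousOn.mul (h.reg_u.continuousOn.sub h.reg_w.continuousOn)).sub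
      ((continuousOn_const.mul (h.reg_n.continuousOn.rpow_const
        fun q hq => Or.inr (by linarith))).mul h.reg_n.continuousOn_deriv)
  have hH0 : H (0, x₀) < 0 := by simp only [hH]; linarith
  set η := -H (0, x₀) / 2 with hη
  have hηpos : 0 < η := by linarith
  obtain ⟨d, hd, hball⟩ := Metric.continuousWithinAt_iff.1 (hHc (0, x₀) ⟨h0, mem_univ _⟩) η hηpos
  set δ := min (min (r / 2) 1) (d / 4) with hδ
  have hδpos : 0 < δ := by simp only [hδ, lt_min_iff]; refine ⟨⟨?_, ?_⟩, ?_⟩ <;> linarith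
  have hδr : δ ≤ r / 2 := (min_le_left _ _).trans (min_le_left _ _)
  have hδ1 : δ ≤ 1 := (min_le_left _ _).trans (min_le_right _ _)
  have hδd : δ ≤ d / 4 := min_le_right _ _
  -- The net source is below `-η` near `(0, x₀)`. With these constants the inertial terms cost at
  -- most `η/4 + η/12` and the two viscous terms `η/12` each, `η/2` in total.
  set ε := η / (4 * C) with hε
  set K := η / (24 * C ^ 2) with hK
  have hεpos : 0 < ε := by positivity
  have hKpos : 0 < K := by positivity
  have hεC : C * ε = η / 4 := by rw [hε]; field_simp
  have hKC : C ^ 2 * K = η / 24 := by rw [hK]; field_simp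
  -- The last entry lets the parabola `K δ²` exceed the growth `C τ` of `w`, together with the
  -- descent `ε τ` of the barrier, on the lateral sides.
  set τ := min (min (T / 2) (d / 2)) (K * δ ^ 2 / (C + ε)) with hτ
  have hτpos : 0 < τ := by
    simp only [hτ, lt_min_iff]; refine ⟨⟨?_, ?_⟩, ?_⟩ <;> positivity
  have hτT : τ < T := ((min_le_left _ _).trans (min_le_left _ _)).trans_lt (by linarith)
  have hτd : τ ≤ d / 2 := (min_le_left _ _).trans (min_le_right _ _)
  have hτK : (C + ε) * τ ≤ K * δ ^ 2 := by
    have : τ ≤ K * δ ^ 2 / (C + ε) := min_le_right _ _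
    rwa [le_div_iff₀' (by positivity)] at this
  refine ⟨ε, hεpos, τ, hτpos, δ, hδpos, by linarith, hτT, fun z hz t ht => ?_⟩
  have main : ∀ e > 0, w t z < e - ε * t + K * (z - z) ^ 2 := by
    intro e he
    refine h.lt_barrier (ψ := fun t x => e - ε * t + K * (x - z) ^ 2) (ψt := fun _ _ => -ε)
      (ψx := fun _ x => 2 * K * (x - z)) (ψxx := fun _ _ => 2 * K) (t₀ := 0) (t₁ := τ)
      (α := z - δ) (β := z + δ) le_rfl hτT (by fun_prop) ?_ ?_ ?_ ?_ ?_ ?_ ?_ t ht z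
      ⟨by linarith, by linarith⟩
    · intro t x
      have := (((hasDerivAt_id t).const_mul ε).const_sub e).add_const (K * (x - z) ^ 2)
      simpa using this
    · intro t x
      have := ((((hasDerivAt_id x).sub_const z).pow 2).const_mul K).const_add (e - ε * t)
      refine this.congr_deriv ?_
      simp; ring
    · intro t x
      have := ((hasDerivAt_id x).sub_const z).const_mul (2 * K)
      simpa using this
    · intro x hx
      have := hw x ⟨by linarith [hx.1, hz.1], by linarith [hx.2, hz.2]⟩
      have h2 : 0 ≤ K * (x - z) ^ 2 := by positivity
      linarith
    · intro s hs
      have h1 := h.reg_w.lip 0 h0 s ⟨hs.1, hs.2.trans hτT.le⟩ (z - δ)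
      have h2 := hw (z - δ) ⟨by linarith [hz.1], by linarith [hz.2]⟩
      rw [sub_zero, abs_of_nonneg hs.1] at h1
      have h3 := (le_abs_self _).trans h1
      have h4 : (C + ε) * s ≤ (C + ε) * τ := by gcongr; exact hs.2
      simp only [sub_sub_cancel_left, neg_sq]
      linarith
    · intro s hs
      have h1 := h.reg_w.lip 0 h0 s ⟨hs.1, hs.2.trans hτT.le⟩ (z + δ)
      have h2 := hw (z + δ) ⟨by linarith [hz.1], by linarith [hz.2]⟩
      rw [sub_zero, abs_of_nonneg hs.1] at h1
      have h3 := (le_abs_self _).trans h1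
      have h4 : (C + ε) * s ≤ (C + ε) * τ := by gcongr; exact hs.2
      simp only [add_sub_cancel_left]
      linarith
    · intro s hs x hx a b heq _ h1 h2 h3 hineq
      have hsI : s ∈ Icc 0 T := ⟨hs.1.le, hs.2.trans hτT.le⟩
      have hHs : H (s, x) < -η := by
        have := hball (x := (s, x)) ⟨hsI, mem_univ _⟩ (by
          rw [Prod.dist_eq, max_lt_iff, Real.dist_eq, Real.dist_eq]
          constructor
          · rw [sub_zero, abs_of_pos hs.1]; linarith [hs.2]
          · rw [abs_lt]; constructor <;> linarith [hx.1, hx.2, hz.1, hz.2])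
        rw [Real.dist_eq, abs_lt] at this
        linarith [this.2]
      have b1 := h.reg_n.abs_le s hsI x
      have b2 := h.reg_w.abs_le s hsI x
      have b3 := h.reg_n.abs_deriv_le s hsI x
      have hxz : |x - z| ≤ 1 := by rw [abs_le]; constructor <;> linarith [hx.1, hx.2]
      rw [← heq] at hineq
      have hHe : ρ s x * (u s x - w s x) - γ * n s x ^ (γ - 1) * deriv (n s) x < -η := hHs
      have e1 : |n s x * (-ε + w s x * (2 * K * (x - z)))| ≤ C * (ε + C * (2 * K * 1)) := by
        rw [abs_mul]
        gcongr
        refine (abs_add_le _ _).trans ?_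
        rw [abs_neg, abs_of_pos hεpos, abs_mul, abs_mul, abs_of_pos (by positivity : 0 < 2 * K)]
        gcongr
      have e2 : |b * deriv (n s) x * (2 * K * (x - z))| ≤ C * C * (2 * K * 1) := by
        rw [abs_mul, abs_mul, abs_mul (2 * K), abs_of_pos (by positivity : 0 < 2 * K)]
        gcongr
      have e3 : a * (2 * K) ≤ C ^ 2 * (2 * K) := by
        gcongr
        exact h2.trans (le_self_pow₀ hC (by norm_num))
      have e1' := (abs_le.1 e1).1
      have e2' := (abs_le.1 e2).2
      have q1 : C * (ε + C * (2 * K * 1)) = η / 4 + η / 12 := by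
        linear_combination hεC + 2 * hKC
      have q2 : C * C * (2 * K * 1) = η / 12 := by linear_combination 2 * hKC
      have q3 : C ^ 2 * (2 * K) = η / 12 := by linear_combination 2 * hKC
      rw [q1] at e1'
      rw [q2] at e2'
      rw [q3] at e3
      linarith
  have : ∀ e > 0, w t z + ε * t ≤ 0 + e := by
    intro e he
    have := main e he
    rw [sub_self] at this
    linarith
  linarith [le_of_forall_pos_le_add this]

end TwoPhaseFlow

/-! ### Propagation of the left layer and domination of the drag -/

/-- Initial data near the left end point of the support: vacuum to the left, growth of `n₀` at an
exponential rate at least `p`, nonpositive `w₀`, and a pressure gradient dominating the drag. -/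
structure LeftLayer (γ p M D : ℝ) (ρ₀ u₀ n₀ w₀ : ℝ → ℝ) : Prop where
  D_pos : 0 < D
  p_pos : 0 < p
  M_pos : 0 < M
  vacuum_ρ : ∀ x ≤ 0, ρ₀ x = 0
  vacuum_n : ∀ x ≤ 0, n₀ x = 0
  ρ_nonneg : ∀ x, 0 ≤ ρ₀ x
  n_pos : ∀ x ∈ Ioc 0 D, 0 < n₀ x
  slope : ∀ x ∈ Ioc 0 D, p * n₀ x ≤ deriv n₀ x
  w_nonpos : ∀ x ∈ Ioc 0 D, w₀ x ≤ 0
  u_le : ∀ x ∈ Ioc 0 D, |u₀ x| ≤ M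
  w_le : ∀ x ∈ Ioc 0 D, |w₀ x| ≤ M
  drag : ∀ x ∈ Ioc 0 D, 16 * M * ρ₀ x ≤ γ * p * n₀ x ^ γ

/-- The slope condition says that `n₀ x * exp (-(p * x))` is nondecreasing. -/
theorem LeftLayer.exp_growth {γ p M D : ℝ} {ρ₀ u₀ n₀ w₀ : ℝ → ℝ}
    (h : LeftLayer γ p M D ρ₀ u₀ n₀ w₀) (hd : Differentiable ℝ n₀) {y z : ℝ} (hy : 0 < y)
    (hyz : y ≤ z) (hz : z ≤ D) : n₀ y * Real.exp (p * (z - y)) ≤ n₀ z := by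
  have hmono : MonotoneOn (fun x => n₀ x * Real.exp (-(p * x))) (Ioc 0 D) := by
    refine monotoneOn_of_hasDerivWithinAt_nonneg (convex_Ioc 0 D)
      (f' := fun x => deriv n₀ x * Real.exp (-(p * x)) + n₀ x * (Real.exp (-(p * x)) * (-(p * 1))))
      ?_ ?_ ?_
    · have := hd.continuous
      fun_prop
    · intro x _
      exact ((hd x).hasDerivAt.mul (((hasDerivAt_id x).const_mul p).neg.exp)).hasDerivWithinAt
    · intro x hx
      have := h.slope x (interior_subset hx)
      have e := Real.exp_pos (-(p * x))
      nlinarith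
  have := hmono ⟨hy, hyz.trans hz⟩ ⟨hy.trans_le hyz, hz⟩ hyz
  calc n₀ y * Real.exp (p * (z - y)) = n₀ y * Real.exp (-(p * y)) * Real.exp (p * z) := by
        rw [mul_assoc, ← Real.exp_add]; ring_nf
    _ ≤ n₀ z * Real.exp (-(p * z)) * Real.exp (p * z) := by gcongr
    _ = n₀ z := by rw [mul_assoc, ← Real.exp_add]; simp

/-- Two integral curves of the same velocity field stay at comparable distance. -/
theorem IsPath.sub_bounds {T C t : ℝ} {v : ℝ → ℝ → ℝ} {A A' : ℝ → ℝ} (hv : BoundedC1 T C v)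
    (hA : IsPath T v A) (hA' : IsPath T v A') (ht : t ∈ Icc 0 T) (hCt : 8 * (C * t) ≤ 1)
    (hlt : A t ≤ A' t) : (∀ s ∈ Icc 0 t, |A' s - A s| ≤ 2 * (A' t - A t)) ∧
      3 / 4 * (A' t - A t) ≤ A' 0 - A 0 := by
  have hsub : Icc 0 t ⊆ Icc 0 T := Icc_subset_Icc_right ht.2
  have hC := hv.nonneg (ht.1.trans ht.2)
  obtain ⟨m, hm, hmax⟩ := isCompact_Icc.exists_isMaxOn (nonempty_Icc.2 ht.1)
    (((hA'.continuousOn.sub hA.continuousOn).mono hsub).abs)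
  set E := |A' m - A m| with hE
  have hEle : ∀ s ∈ Icc 0 t, |A' s - A s| ≤ E := fun s hs => hmax hs
  have hincr : ∀ s ∈ Icc 0 t, |(A' s - A s) - (A' t - A t)| ≤ C * E * t := by
    intro s hs
    have := Convex.norm_image_sub_le_of_norm_hasDerivWithin_le (𝕜 := ℝ) (f := fun s => A' s - A s)
      (f' := fun s => v s (A' s) - v s (A s)) (s := Icc 0 t) (C := C * E)
      (fun r hr => ((hA' r (hsub hr)).sub (hA r (hsub hr))).mono hsub)
      (fun r hr => by
        rw [Real.norm_eq_abs]
        exact (hv.lip_x (hsub hr) _ _).trans (by gcongr; exact hEle r hr))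
      (convex_Icc 0 t) (right_mem_Icc.2 ht.1) hs
    rw [Real.norm_eq_abs, Real.norm_eq_abs] at this
    refine this.trans ?_
    gcongr
    rw [abs_le]
    constructor <;> linarith [hs.1, hs.2]
  have hE0 : 0 ≤ E := abs_nonneg _
  -- The gap varies by at most `E / 8`, where `E` is its maximum. So `E` is at most twice the final
  -- gap, and the initial gap loses at most a quarter of the final one.
  have hsmall : C * E * t ≤ E / 8 := by nlinarith
  have hE2 : E ≤ 2 * (A' t - A t) := by
    have h1 := hincr m hm
    have h2 := abs_sub_abs_le_abs_sub (A' m - A m) (A' t - A t)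
    rw [abs_of_nonneg (by linarith : 0 ≤ A' t - A t), ← hE] at h2
    linarith
  refine ⟨fun s hs => (hEle s hs).trans hE2, ?_⟩
  have h3 := (abs_le.1 (hincr 0 (left_mem_Icc.2 ht.1))).1
  linarith

namespace TwoPhaseFlow

variable {T C γ p M D W : ℝ} {ρ u n w : ℝ → ℝ → ℝ}

/-- The initial exponential growth of `n` propagates for a short time. -/
theorem slope_n (h : TwoPhaseFlow T C γ ρ u n w) (h0 : LeftLayer γ p M D (ρ 0) (u 0) (n 0) (w 0))
    (hW : ∀ t ∈ Ioo 0 T, ∀ x, |deriv (deriv (w t)) x| ≤ W) {t x : ℝ} (ht : t ∈ Ioo 0 T)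
    (hCt : 8 * (C * t) ≤ 1) (hWt : 8 * (W * t) ≤ p) (hx : x + C * t < D) :
    p / 2 * n t x ≤ deriv (n t) x := by
  have hI := Ioo_subset_Icc_self ht
  have hT : 0 < T := ht.1.trans ht.2
  have hz : (0:ℝ) ∈ Icc 0 T := ⟨le_rfl, hT.le⟩
  -- A zero of `n t` is a minimum, so the slope vanishes there.
  rcases eq_or_lt_of_le (h.n_nonneg t hI x) with e | hpos
  · have hmin : IsLocalMin (n t) x := Filter.Eventually.of_forall fun y => by
      rw [← e]; exact h.n_nonneg t hI y
    rw [hmin.deriv_eq_zero, ← e, mul_zero]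
  obtain ⟨A, hAt, hA⟩ := h.reg_w.exists_path hI x
  have hform : n t x = n 0 (A 0) * _ := hAt ▸ transport_formula h.reg_n h.reg_w h.mass_n hA hI
  have hA0 : 0 < A 0 := by
    by_contra! hneg
    rw [h0.vacuum_n _ hneg, zero_mul] at hform
    linarith
  -- Difference quotients are estimated along two paths, which avoids differentiating the flow map.
  have key : ∀ x' > x, x' + C * t < D → p / 2 * n t x * (x' - x) ≤ n t x' - n t x := by
    intro x' hx' hx'D
    obtain ⟨A', hAt', hA'⟩ := h.reg_w.exists_path hI x'
    have hform' := transport_formula h.reg_n h.reg_w h.mass_n hA' hI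
    have hform2 := transport_formula h.reg_n h.reg_w h.mass_n hA hI
    obtain ⟨hd1, hd2⟩ := IsPath.sub_bounds h.reg_w hA hA' hI hCt (by rw [hAt, hAt']; exact hx'.le)
    rw [hAt, hAt'] at hd1 hd2
    rw [hAt'] at hform'
    rw [hAt] at hform2
    have hA'D : A' 0 ≤ D := by
      have := hA'.abs_sub_le h.reg_w hI hz
      rw [hAt', zero_sub, abs_neg, abs_of_pos ht.1] at this
      linarith [le_abs_self (A' 0 - x')]
    have hgrow := h0.exp_growth (h.reg_n.diff_x 0 hz) hA0 (by linarith) hA'D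
    set J := ∫ s in (0:ℝ)..t, deriv (w s) (A s) with hJ
    set J' := ∫ s in (0:ℝ)..t, deriv (w s) (A' s) with hJ'
    have hJJ : |J' - J| ≤ W * (2 * (x' - x)) * t := by
      have hint : ∀ {B}, IsPath T w B →
          IntervalIntegrable (fun s => deriv (w s) (B s)) volume 0 t := fun hB =>
        ((hB.continuousOn_comp h.reg_w.continuousOn_deriv).mono
          (Icc_subset_Icc_right ht.2.le)).intervalIntegrable_of_Icc ht.1.le
      rw [hJ, hJ', ← intervalIntegral.integral_sub (hint hA') (hint hA)]
      have := intervalIntegral.norm_integral_le_of_norm_le_const (a := 0) (b := t)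
        (C := W * (2 * (x' - x))) (f := fun s => deriv (w s) (A' s) - deriv (w s) (A s)) (by
          intro s hs
          rw [uIoc_of_le ht.1.le] at hs
          have hsT : s ∈ Ioo 0 T := ⟨hs.1, hs.2.trans_lt ht.2⟩
          rw [Real.norm_eq_abs]
          refine (h.lip_deriv_w hW hsT _ _).trans ?_
          have hW0 : 0 ≤ W := (abs_nonneg _).trans (hW s hsT 0)
          gcongr
          exact hd1 s ⟨hs.1.le, hs.2⟩)
      rwa [Real.norm_eq_abs, sub_zero, abs_of_pos ht.1] at this
    have hp := h0.p_pos
    -- The initial gap contributes `3/4 p`; the change in the compression integral costs at most `2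
    -- W t ≤ p/4`.
    have hexp : p / 2 * (x' - x) - J ≤ p * (A' 0 - A 0) - J' := by
      have := (abs_le.1 hJJ).2
      have h1 : p * (3 / 4 * (x' - x)) ≤ p * (A' 0 - A 0) := by gcongr
      have h2 : 8 * (W * t) * (x' - x) ≤ p * (x' - x) := by
        have : 0 < x' - x := by linarith
        gcongr
      nlinarith
    have hn0 : 0 < n 0 (A 0) := h0.n_pos _ ⟨hA0, by linarith⟩
    have : n t x * Real.exp (p / 2 * (x' - x)) ≤ n t x' := by
      rw [hform2, hform']
      calc n 0 (A 0) * Real.exp (-J) * Real.exp (p / 2 * (x' - x))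
          = n 0 (A 0) * Real.exp (p / 2 * (x' - x) - J) := by
            rw [mul_assoc, ← Real.exp_add]; ring_nf
        _ ≤ n 0 (A 0) * Real.exp (p * (A' 0 - A 0) - J') := by gcongr
        _ = n 0 (A 0) * Real.exp (p * (A' 0 - A 0)) * Real.exp (-J') := by
            rw [mul_assoc, ← Real.exp_add]; ring_nf
        _ ≤ _ := by gcongr
    have h3 := Real.add_one_le_exp (p / 2 * (x' - x))
    nlinarith
  have lim : Filter.Tendsto (slope (n t) x) (nhdsWithin x (Ioi x)) (nhds (deriv (n t) x)) :=
    (hasDerivAt_iff_tendsto_slope.1 (h.reg_n.diff_x t hI x).hasDerivAt).mono_left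
      (nhdsWithin_mono _ fun s hs => ne_of_gt hs)
  refine ge_of_tendsto lim ?_
  filter_upwards [Ioo_mem_nhdsGT (show x < D - C * t by linarith)] with y hy
  rw [slope_def_field, le_div_iff₀ (by linarith [hy.1])]
  exact key y hy.1 (by linarith [hy.2])

theorem ρ_nonneg (h : TwoPhaseFlow T C γ ρ u n w) (h0 : ∀ x, 0 ≤ ρ 0 x) {t : ℝ} (ht : t ∈ Icc 0 T)
    (x : ℝ) : 0 ≤ ρ t x := by
  obtain ⟨A, hAt, hA⟩ := h.reg_u.exists_path ht x
  rw [← hAt, transport_formula h.reg_ρ h.reg_u h.mass_ρ hA ht]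
  exact mul_nonneg (h0 _) (Real.exp_pos _).le

/-- The drag is dominated by the pressure gradient at points where the path of the first phase
started to the left of the path of the second phase. -/
theorem drag_le (h : TwoPhaseFlow T C γ ρ u n w) (hγ : 1 < γ)
    (h0 : LeftLayer γ p M D (ρ 0) (u 0) (n 0) (w 0))
    (hW : ∀ t ∈ Ioo 0 T, ∀ x, |deriv (deriv (w t)) x| ≤ W) {t x : ℝ} (ht : t ∈ Ioo 0 T)
    (hCt : 8 * (C * t) ≤ 1) (hWt : 8 * (W * t) ≤ p) (hx : x + C * t < D)
    (hγt : (γ + 1) * (C * t) ≤ 1) (hMt : (C + C * C) * t ≤ M)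
    (horder : 0 < u t x → ρ t x ≠ 0 → ∃ A B, A t = x ∧ B t = x ∧ IsPath T u A ∧ IsPath T w B ∧
      A 0 ≤ B 0) :
    ρ t x * u t x ≤ γ * n t x ^ (γ - 1) * deriv (n t) x := by
  have hI := Ioo_subset_Icc_self ht
  have hT : 0 < T := ht.1.trans ht.2
  have hz : (0:ℝ) ∈ Icc 0 T := ⟨le_rfl, hT.le⟩
  have hC := h.one_le
  have hp := h0.p_pos
  have hM := h0.M_pos
  have hslope := h.slope_n h0 hW ht hCt hWt hx
  have hn := h.n_nonneg t hI x
  have hρ := h.ρ_nonneg h0.ρ_nonneg hI x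
  have hpow : n t x ^ (γ - 1) * n t x = n t x ^ γ := by
    rcases eq_or_lt_of_le hn with e | e
    · rw [← e, mul_zero, Real.zero_rpow (by linarith)]
    · rw [← Real.rpow_add_one e.ne']; ring_nf
  have hpress : γ * (p / 2) * n t x ^ γ ≤ γ * n t x ^ (γ - 1) * deriv (n t) x := by
    calc γ * (p / 2) * n t x ^ γ = γ * n t x ^ (γ - 1) * (p / 2 * n t x) := by rw [← hpow]; ring
      _ ≤ _ := by gcongr
  refine le_trans ?_ hpress
  by_cases hu : 0 < u t x; swap
  · have : ρ t x * u t x ≤ 0 := mul_nonpos_of_nonneg_of_nonpos hρ (not_lt.1 hu)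
    exact this.trans (by positivity)
  by_cases hρ0 : ρ t x = 0
  · rw [hρ0, zero_mul]; positivity
  obtain ⟨A, B, hAt, hBt, hA, hB, hAB⟩ := horder hu hρ0
  have fρ := transport_formula h.reg_ρ h.reg_u h.mass_ρ hA hI
  have fn := transport_formula h.reg_n h.reg_w h.mass_n hB hI
  have Iρ := abs_integral_deriv_le (A := A) h.reg_u hI
  have In := abs_integral_deriv_le (A := B) h.reg_w hI
  rw [hAt] at fρ
  rw [hBt] at fn
  have dA := hA.abs_sub_le h.reg_u hI hz
  have dB := hB.abs_sub_le h.reg_w hI hz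
  rw [zero_sub, abs_neg, abs_of_pos ht.1] at dA dB
  rw [hAt] at dA
  rw [hBt] at dB
  have hA0 : 0 < A 0 := by
    by_contra! hneg
    rw [h0.vacuum_ρ _ hneg, zero_mul] at fρ
    exact hρ0 fρ
  have hBD : B 0 ≤ D := by linarith [le_abs_self (B 0 - x)]
  have hu2 : u t x ≤ 2 * M := by
    have l1 := h.reg_u.lip 0 hz t hI x
    have l2 := h.reg_u.lip_x hz x (A 0)
    rw [sub_zero, abs_of_pos ht.1] at l1
    rw [abs_sub_comm x] at l2
    have l3 : C * |A 0 - x| ≤ C * (C * t) := by gcongr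
    have := h0.u_le (A 0) ⟨hA0, hAB.trans hBD⟩
    linarith [le_abs_self (u t x - u 0 x), le_abs_self (u 0 x - u 0 (A 0)), le_abs_self (u 0 (A 0))]
  have hnA : 0 < n 0 (A 0) := h0.n_pos _ ⟨hA0, hAB.trans hBD⟩
  have hnAB : n 0 (A 0) ≤ n 0 (B 0) := by
    refine le_trans ?_ (h0.exp_growth (h.reg_n.diff_x 0 hz) hA0 hAB hBD)
    exact le_mul_of_one_le_right hnA.le (Real.one_le_exp (mul_nonneg hp.le (by linarith)))
  have hdrag := h0.drag (A 0) ⟨hA0, hAB.trans hBD⟩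
  have e1 : ρ t x ≤ ρ 0 (A 0) * Real.exp (C * t) := by
    rw [fρ]
    gcongr
    · exact h0.ρ_nonneg _
    · linarith [neg_abs_le (∫ s in (0:ℝ)..t, deriv (u s) (A s))]
  have e2 : n 0 (A 0) ^ γ * Real.exp (-(γ * (C * t))) ≤ n t x ^ γ := by
    have : n 0 (A 0) * Real.exp (-(C * t)) ≤ n t x := by
      rw [fn]
      refine mul_le_mul hnAB (Real.exp_le_exp.2 ?_) (Real.exp_pos _).le (hnA.le.trans hnAB)
      linarith [le_abs_self (∫ s in (0:ℝ)..t, deriv (w s) (B s))]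
    calc n 0 (A 0) ^ γ * Real.exp (-(γ * (C * t))) = (n 0 (A 0) * Real.exp (-(C * t))) ^ γ := by
          rw [Real.mul_rpow hnA.le (Real.exp_pos _).le, ← Real.exp_mul]; ring_nf
      _ ≤ _ := by gcongr
  have e3 : Real.exp (C * t) ≤ 4 * Real.exp (-(γ * (C * t))) := by
    have : Real.exp ((γ + 1) * (C * t)) ≤ 4 := by
      refine (Real.exp_le_exp.2 hγt).trans ?_
      linarith [Real.exp_one_lt_d9]
    calc Real.exp (C * t) = Real.exp ((γ + 1) * (C * t)) * Real.exp (-(γ * (C * t))) := by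
          rw [← Real.exp_add]; ring_nf
      _ ≤ _ := by gcongr
  have hρA := h0.ρ_nonneg (A 0)
  -- The constant 16 of `LeftLayer.drag` is a factor 4 from the exponentials, 2 from `u ≤ 2 M` and 2
  -- from the halved slope `p / 2`.
  calc ρ t x * u t x ≤ (ρ 0 (A 0) * Real.exp (C * t)) * (2 * M) := by gcongr
    _ ≤ (ρ 0 (A 0) * (4 * Real.exp (-(γ * (C * t))))) * (2 * M) := by gcongr
    _ = (16 * M * ρ 0 (A 0)) / 2 * Real.exp (-(γ * (C * t))) := by ring
    _ ≤ (γ * p * n 0 (A 0) ^ γ) / 2 * Real.exp (-(γ * (C * t))) := by gcongr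
    _ = γ * (p / 2) * (n 0 (A 0) ^ γ * Real.exp (-(γ * (C * t)))) := by ring
    _ ≤ _ := by gcongr

/-- If `w` lies below the barrier `ε (2 + c s - exp (k (y - E)))` up to time `t`, then at a point
where `u` lies above it the path of the first phase started to the left of that of the second. -/
theorem paths_ordered (h : TwoPhaseFlow T C γ ρ u n w) {ε c k E t x : ℝ} (ht : t ∈ Ioo 0 T)
    (hε : 0 ≤ ε) (hk : 0 ≤ k) (hc : k * C ≤ c) (hx : x + C * t ≤ E)
    (hw : ∀ s ∈ Icc 0 t, ∀ y ≤ E, w s y ≤ ε * (2 + c * s - Real.exp (k * (y - E))))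
    (hu : ε * (2 + c * t - Real.exp (k * (x - E))) < u t x) (hρ : ρ t x ≠ 0) :
    ∃ A B, A t = x ∧ B t = x ∧ IsPath T u A ∧ IsPath T w B ∧ A 0 ≤ B 0 := by
  have hI := Ioo_subset_Icc_self ht
  have hsub : Icc 0 t ⊆ Icc 0 T := Icc_subset_Icc_right ht.2.le
  obtain ⟨A, hAt, hA⟩ := h.reg_u.exists_path hI x
  obtain ⟨B, hBt, hB⟩ := h.reg_w.exists_path hI x
  refine ⟨A, B, hAt, hBt, hA, hB, ?_⟩
  have hC := h.one_le
  have hρA : ρ 0 (A 0) ≠ 0 := by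
    intro hzero
    have := transport_formula h.reg_ρ h.reg_u h.mass_ρ hA hI
    rw [hAt, hzero, zero_mul] at this
    exact hρ this
  have hAE : ∀ s ∈ Icc 0 t, A s ≤ E := by
    intro s hs
    have := hA.abs_sub_le h.reg_u hI (hsub hs)
    rw [hAt] at this
    have h2 : |s - t| ≤ t := by rw [abs_le]; constructor <;> linarith [hs.1, hs.2]
    have h3 : C * |s - t| ≤ C * t := by gcongr
    linarith [le_abs_self (A s - x)]
  set Φ : ℝ → ℝ := fun s => ε * (2 + c * s - Real.exp (k * (A s - E))) with hΦ
  -- Along `A` the momentum equation reads `u' = w - u`, so `g' = exp s * (w - Φ - Φ')`. This is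
  -- nonpositive because `w ≤ Φ`, and `c ≥ k C` makes `Φ' ≥ 0`. Hence `u > Φ` at time `t` holds at
  -- all earlier times.
  set g : ℝ → ℝ := fun s => Real.exp s * (u s (A s) - Φ s) with hg
  have hAc : ContinuousOn A (Icc 0 t) := hA.continuousOn.mono hsub
  have hgc : ContinuousOn g (Icc 0 t) := by
    have : ContinuousOn (fun s => u s (A s)) (Icc 0 t) :=
      (hA.continuousOn_comp h.reg_u.continuousOn).mono hsub
    exact Real.continuous_exp.continuousOn.mul (this.sub (by simp only [hΦ]; fun_prop))
  have hgd : ∀ s ∈ Ioo 0 t, HasDerivAt g (Real.exp s * (w s (A s) - Φ s -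
      ε * (c - Real.exp (k * (A s - E)) * (k * u s (A s))))) s := by
    intro s hs
    have hsT : s ∈ Ioo 0 T := ⟨hs.1, hs.2.trans ht.2⟩
    have d1 := h.reg_u.hasDerivAt_comp hsT (hA.hasDerivAt hsT)
    have d2 : HasDerivAt Φ (ε * (c - Real.exp (k * (A s - E)) * (k * u s (A s)))) s := by
      have := (((hasDerivAt_id s).const_mul c).const_add 2).sub
        ((((hA.hasDerivAt hsT).sub_const E).const_mul k).exp)
      simpa using this.const_mul ε
    refine ((Real.hasDerivAt_exp s).mul (d1.sub d2)).congr_deriv ?_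
    have hne : ρ s (A s) ≠ 0 := by
      rw [transport_formula h.reg_ρ h.reg_u h.mass_ρ hA (Ioo_subset_Icc_self hsT)]
      exact mul_ne_zero hρA (Real.exp_ne_zero _)
    have hmom := (mul_eq_zero.1 (h.momentum_u s hsT (A s))).resolve_left hne
    simp only [Pi.sub_apply]
    linear_combination Real.exp s * hmom
  have hanti : AntitoneOn g (Icc 0 t) := by
    refine antitoneOn_of_hasDerivWithinAt_nonpos (convex_Icc 0 t) hgc
      (fun s hs => (hgd s (by simpa using hs)).hasDerivWithinAt) fun s hs => ?_
    rw [interior_Icc] at hs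
    have hs' := Ioo_subset_Icc_self hs
    refine mul_nonpos_of_nonneg_of_nonpos (Real.exp_pos _).le ?_
    have h1 := hw s hs' (A s) (hAE s hs')
    have h2 : Real.exp (k * (A s - E)) * (k * u s (A s)) ≤ 1 * (k * C) := by
      have hu' := (le_abs_self _).trans (h.reg_u.abs_le s (hsub hs') (A s))
      have he : Real.exp (k * (A s - E)) ≤ 1 := Real.exp_le_one_iff.2
        (mul_nonpos_of_nonneg_of_nonpos hk (by linarith [hAE s hs']))
      calc Real.exp (k * (A s - E)) * (k * u s (A s)) ≤ Real.exp (k * (A s - E)) * (k * C) := by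
            gcongr
        _ ≤ _ := by gcongr
    have h3 : 0 ≤ ε * (c - Real.exp (k * (A s - E)) * (k * u s (A s))) :=
      mul_nonneg hε (by linarith)
    simp only [hΦ]
    linarith
  have hpos : ∀ s ∈ Icc 0 t, Φ s < u s (A s) := by
    intro s hs
    have h1 := hanti hs (right_mem_Icc.2 ht.1.le) hs.2
    have h2 : 0 < g t := by
      simp only [hg, hΦ, hAt]
      exact mul_pos (Real.exp_pos _) (by linarith)
    have h3 : 0 < g s := h2.trans_le h1
    exact sub_pos.1 ((mul_pos_iff_of_pos_left (Real.exp_pos s)).1 h3)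
  -- If `A` started to the right, then at the first meeting the gap `A - B` reaches `0` from above,
  -- which forces `u ≤ w`; but `u > Φ ≥ w` there.
  by_contra! hlt
  have hDc : ContinuousOn (fun s => A s - B s) (Icc 0 t) := hAc.sub (hB.continuousOn.mono hsub)
  set K := {s ∈ Icc 0 t | A s - B s ∈ Iic 0} with hK
  have hKc : IsCompact K := isCompact_Icc.of_isClosed_subset
    (hDc.preimage_isClosed_of_isClosed isClosed_Icc isClosed_Iic) fun s hs => hs.1
  obtain ⟨s, ⟨hs, hs0⟩, hmin⟩ := hKc.exists_isMinOn
    ⟨t, right_mem_Icc.2 ht.1.le, by simp [hAt, hBt]⟩ continuousOn_id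
  simp only [mem_Iic] at hs0
  have hbefore : ∀ r ∈ Ico 0 s, 0 < A r - B r := by
    intro r hr
    by_contra! hc
    exact absurd (hmin (a := r) ⟨⟨hr.1, hr.2.le.trans hs.2⟩, hc⟩) (not_le.2 hr.2)
  have hspos : 0 < s := by
    rcases eq_or_lt_of_le hs.1 with e | e
    · rw [← e] at hs0; linarith
    · exact e
  have hzero : A s - B s = 0 := by
    refine le_antisymm hs0 ?_
    have : (nhdsWithin s (Ioo 0 s)).NeBot := right_nhdsWithin_Ioo_neBot hspos
    refine ge_of_tendsto ((hDc s hs).mono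
      (Ioo_subset_Icc_self.trans (Icc_subset_Icc_right hs.2))) ?_
    filter_upwards [self_mem_nhdsWithin] with r hr
    exact (hbefore r ⟨hr.1.le, hr.2⟩).le
  have hsT : s ∈ Ioo 0 T := ⟨hspos, hs.2.trans_lt ht.2⟩
  have hd := nonneg_of_hasDerivAt_of_nonpos_left
    ((hB.hasDerivAt hsT).sub (hA.hasDerivAt hsT)) hspos
    (by simp only [Pi.sub_apply]; linarith) fun r hr => by
      have := hbefore r ⟨hr.1.le, hr.2⟩
      simp only [Pi.sub_apply]; linarith
  have hAB : B s = A s := by linarith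
  rw [hAB] at hd
  have := hw s hs (A s) (hAE s hs)
  have := hpos s hs
  simp only [hΦ] at this
  linarith

end TwoPhaseFlow

theorem LeftLayer.source_lt {γ p M D : ℝ} {ρ₀ u₀ n₀ w₀ : ℝ → ℝ}
    (h : LeftLayer γ p M D ρ₀ u₀ n₀ w₀) (hγ : 1 < γ) {x : ℝ} (hx : x ∈ Ioc 0 D) :
    ρ₀ x * (u₀ x - w₀ x) < γ * n₀ x ^ (γ - 1) * deriv n₀ x := by
  have hn := h.n_pos x hx
  have hp := h.p_pos
  have hM := h.M_pos
  have h1 : ρ₀ x * (u₀ x - w₀ x) ≤ ρ₀ x * (M + M) := by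
    have := h.ρ_nonneg x
    gcongr
    linarith [le_abs_self (u₀ x), neg_abs_le (w₀ x), h.u_le x hx, h.w_le x hx]
  have h2 : γ * p * n₀ x ^ γ ≤ γ * n₀ x ^ (γ - 1) * deriv n₀ x := by
    have : n₀ x ^ (γ - 1) * n₀ x = n₀ x ^ γ := by
      rw [← Real.rpow_add_one hn.ne']; ring_nf
    calc γ * p * n₀ x ^ γ = γ * n₀ x ^ (γ - 1) * (p * n₀ x) := by rw [← this]; ring
      _ ≤ _ := by gcongr; exact h.slope x hx
  have h3 := h.drag x hx
  have h4 : 0 < γ * p * n₀ x ^ γ := by positivity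
  linarith

/-! ### Sign of `w`, its spreading, and the contradiction -/

namespace TwoPhaseFlow

variable {T C γ p M D W : ℝ} {ρ u n w : ℝ → ℝ → ℝ}

/-- `w` stays nonpositive near the left end point. -/
theorem w_nonpos (h : TwoPhaseFlow T C γ ρ u n w) (hγ : 1 < γ)
    (h0 : LeftLayer γ p M D (ρ 0) (u 0) (n 0) (w 0))
    (hW : ∀ t ∈ Ioo 0 T, ∀ x, |deriv (deriv (w t)) x| ≤ W) {τ α x₀ δ : ℝ} (hτ : τ < T)
    (hCτ : 8 * (C * τ) ≤ 1) (hWτ : 8 * (W * τ) ≤ p) (hCδ : C * τ ≤ δ) (hδ : 0 < δ)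
    (hγτ : (γ + 1) * (C * τ) ≤ 1) (hMτ : (C + C * C) * τ ≤ M) (hD : x₀ + δ < D)
    (hα : α < x₀)
    (hfar : ∀ t ∈ Icc 0 τ, ∀ x ≤ α, w t x = 0)
    (hpush : ∀ z ∈ Icc (x₀ - δ) (x₀ + δ), ∀ t ∈ Icc 0 τ, w t z ≤ 0) :
    ∀ t ∈ Icc 0 τ, ∀ x ≤ x₀ + δ, w t x ≤ 0 := by
  intro t ht x hx
  have hT : 0 < T := (ht.1.trans ht.2).trans_lt hτ
  have hC := h.one_le
  have hC0 : 0 < C := by linarith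
  set E := x₀ + δ with hE
  -- `k` gives `a k > C²`, so the concavity of the barrier beats the term with `β n_x`. The rate `c
  -- = k C` compensates advection by `w`, and is also what `paths_ordered` requires.
  set k := C ^ 3 + 1 with hk
  set c := k * C with hc
  have hk0 : 0 < k := by positivity
  have main : ∀ e > 0, ∀ t ∈ Icc 0 τ, ∀ x ∈ Icc α x₀,
      w t x < e * (2 + c * t - Real.exp (k * (x - E))) := by
    intro e he
    have hψ : ∀ s ∈ Icc 0 τ, ∀ y ≤ E, 0 < e * (2 + c * s - Real.exp (k * (y - E))) := by
      intro s hs y hy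
      have : Real.exp (k * (y - E)) ≤ 1 := Real.exp_le_one_iff.2
        (mul_nonpos_of_nonneg_of_nonpos hk0.le (by linarith))
      have h2 : 0 ≤ c * s := mul_nonneg (by positivity) hs.1
      exact mul_pos he (by linarith)
    refine h.lt_barrier (ψ := fun t x => e * (2 + c * t - Real.exp (k * (x - E))))
      (ψt := fun _ _ => e * c) (ψx := fun _ x => -(e * k * Real.exp (k * (x - E))))
      (ψxx := fun _ x => -(e * k * (k * Real.exp (k * (x - E))))) le_rfl hτ (by fun_prop)
      ?_ ?_ ?_ ?_ ?_ ?_ ?_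
    · intro t x
      have := ((((hasDerivAt_id t).const_mul c).const_add 2).sub_const
        (Real.exp (k * (x - E)))).const_mul e
      simpa using this
    · intro t x
      have := (((((hasDerivAt_id x).sub_const E).const_mul k).exp).const_sub (2 + c * t)).const_mul e
      refine this.congr_deriv ?_
      simp only [id]; ring
    · intro t x
      have := (((((hasDerivAt_id x).sub_const E).const_mul k).exp).const_mul (e * k)).neg
      refine this.congr_deriv ?_
      simp only [id]; ring
    · intro x hx
      refine lt_of_le_of_lt ?_ (hψ 0 ⟨le_rfl, ht.1.trans ht.2⟩ x (by linarith [hx.2]))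
      rcases le_or_gt x 0 with hx0 | hx0
      · exact (h.w_zero_eq_zero hT h0.vacuum_ρ h0.vacuum_n hx0).le
      · exact h0.w_nonpos x ⟨hx0, by linarith [hx.2]⟩
    · intro s hs
      rw [hfar s hs α le_rfl]
      exact hψ s hs α (by linarith)
    · intro s hs
      exact (hpush x₀ ⟨by linarith, by linarith⟩ s hs).trans_lt (hψ s hs x₀ (by linarith))
    · intro s hs x hx a b heq hbelow h1 h2 h3 hineq
      have hsτ : s ∈ Icc 0 τ := ⟨hs.1.le, hs.2⟩
      have hsT : s ∈ Ioo 0 T := ⟨hs.1, hs.2.trans_lt hτ⟩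
      have hsI := Ioo_subset_Icc_self hsT
      have hCs : C * s ≤ C * τ := by gcongr; exact hs.2
      have hWs : W * s ≤ W * τ := by
        have : 0 ≤ W := (abs_nonneg _).trans (hW s hsT 0)
        gcongr; exact hs.2
      have cCs : 8 * (C * s) ≤ 1 := by linarith
      have cWs : 8 * (W * s) ≤ p := by linarith
      have cγs : (γ + 1) * (C * s) ≤ 1 := le_trans (by gcongr) hγτ
      have cMs : (C + C * C) * s ≤ M := le_trans (by gcongr; exact hs.2) hMτ
      have cx : x + C * s < D := by linarith [hx.2]
      have hρ := h.ρ_nonneg h0.ρ_nonneg hsI x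
      have hn := h.n_nonneg s hsI x
      have hnx : 0 ≤ deriv (n s) x :=
        le_trans (by have := h0.p_pos; positivity) (h.slope_n h0 hW hsT cCs cWs cx)
      have hψpos := hψ s hsτ x (by linarith [hx.2])
      set ψ := e * (2 + c * s - Real.exp (k * (x - E))) with hψdef
      -- Drag matters only where `u > ψ`, and there the paths are ordered. The bound `w ≤` barrier
      -- needed up to time `s` comes from rest for `y ≤ α`, from first contact up to `x₀`, and from
      -- the push beyond.
      have hsrc : ρ s x * (u s x - ψ) ≤ γ * n s x ^ (γ - 1) * deriv (n s) x := by
        rcases le_or_gt (u s x) ψ with hu | hu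
        · exact (mul_nonpos_of_nonneg_of_nonpos hρ (by linarith)).trans (by positivity)
        · refine le_trans (by gcongr; linarith) (h.drag_le hγ h0 hW hsT cCs cWs cx cγs cMs ?_)
          intro _ hρ0
          refine h.paths_ordered hsT he.le hk0.le le_rfl (by linarith [hx.2]) ?_ hu hρ0
          intro r hr y hy
          have hrτ : r ∈ Icc 0 τ := ⟨hr.1, hr.2.trans hs.2⟩
          rcases le_or_gt y α with hyα | hyα
          · rw [hfar r hrτ y hyα]; exact (hψ r hrτ y hy).le
          rcases le_or_gt y x₀ with hyx | hyx
          · exact hbelow r hr y ⟨hyα.le, hyx⟩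
          · exact (hpush y ⟨by linarith, hy⟩ r hrτ).trans (hψ r hrτ y hy).le
      have hex : 0 < Real.exp (k * (x - E)) := Real.exp_pos _
      have hex1 : Real.exp (k * (x - E)) ≤ 1 := Real.exp_le_one_iff.2
        (mul_nonpos_of_nonneg_of_nonpos hk0.le (by linarith [hx.2]))
      set X := Real.exp (k * (x - E)) with hX
      have hψC : ψ ≤ C := by
        rw [← heq]; exact (le_abs_self _).trans (h.reg_w.abs_le s hsI x)
      have l1 : 0 ≤ n s x * (e * c + ψ * -(e * k * X)) := by
        refine mul_nonneg hn ?_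
        have : ψ * (e * k * X) ≤ C * (e * k * 1) := by gcongr
        rw [hc]
        linarith
      have hbn : -(b * deriv (n s) x) ≤ C * C := by
        refine (neg_le_abs _).trans ?_
        rw [abs_mul]
        gcongr
        exact h.reg_n.abs_deriv_le s hsI x
      have hak : C ^ 2 < a * k := by
        calc C ^ 2 = C⁻¹ * C ^ 3 := by field_simp
          _ < C⁻¹ * k := by rw [hk]; gcongr; linarith
          _ ≤ a * k := by gcongr
      have hY : 0 < e * k * X := by positivity
      have l2 : -(b * deriv (n s) x) * (e * k * X) ≤ C * C * (e * k * X) := by gcongr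
      have l3 : C ^ 2 * (e * k * X) < a * k * (e * k * X) := by gcongr
      linarith
  rcases le_or_gt x α with hxα | hxα
  · exact (hfar t ht x hxα).le
  rcases le_or_gt x x₀ with hxx | hxx
  · have hb : 0 < 2 + c * t := by have := ht.1; positivity
    refine le_of_forall_pos_le_add fun e he => ?_
    have := main (e / (2 + c * t)) (by positivity) t ht x ⟨hxα.le, hxx⟩
    have h2 : e / (2 + c * t) * (2 + c * t - Real.exp (k * (x - E))) ≤
        e / (2 + c * t) * (2 + c * t) := by
      gcongr
      linarith [Real.exp_pos (k * (x - E))]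
    rw [div_mul_cancel₀ _ hb.ne'] at h2
    linarith
  · exact hpush x ⟨by linarith, hx⟩ t ht

/-- Negativity of `w` spreads to the left with arbitrary speed. -/
theorem exists_neg (h : TwoPhaseFlow T C γ ρ u n w) (hρ : ∀ x, 0 ≤ ρ 0 x) {t₀ t₁ x₀ δ c₀ : ℝ}
    (ht₀ : 0 ≤ t₀) (ht : t₀ < t₁) (ht₁ : t₁ < T) (hx₀ : 0 < x₀) (hδ : 0 < δ) (hc₀ : 0 < c₀)
    (hneg : ∀ t ∈ Icc t₀ t₁, ∀ x ∈ Icc (x₀ - δ) x₀, w t x ≤ -c₀)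
    (hle : ∀ t ∈ Icc t₀ t₁, ∀ x ≤ x₀, w t x ≤ 0)
    (hsrc : ∀ t ∈ Ioc t₀ t₁, ∀ x ≤ x₀,
      ρ t x * u t x ≤ γ * n t x ^ (γ - 1) * deriv (n t) x) :
    w t₁ (-2 * δ) < 0 := by
  have hC := h.one_le
  have hC0 : 0 < C := by linarith
  -- Speed of the front `r`, the zero of the barrier: it moves from `x₀ - δ` to `-3 * δ`, past the
  -- target point `-2 * δ`.
  set N := (x₀ + 2 * δ) / (t₁ - t₀) with hN
  have htt : 0 < t₁ - t₀ := by linarith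
  have hN0 : 0 < N := by positivity
  have hNt : N * (t₁ - t₀) = x₀ + 2 * δ := by rw [hN]; field_simp
  -- Steep enough that `C⁻¹ k²` exceeds `C (N + C) k + C² k + C`, the sum of the inertial, viscous
  -- first-order and drag contributions.
  set k := C * (C * N + 2 * C ^ 2 + C) + 1 with hk
  have hk1 : 1 ≤ k := by
    have : 0 ≤ C * (C * N + 2 * C ^ 2 + C) := by positivity
    linarith
  -- Small enough that the barrier stays above `-c₀` for all `x ≤ x₀`.
  set κ := c₀ * Real.exp (-(k * (x₀ + 3 * δ))) with hκ
  have hκ0 : 0 < κ := by positivity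
  set r : ℝ → ℝ := fun t => x₀ - δ - N * (t - t₀) with hr
  have hr1 : r t₁ = -3 * δ := by simp only [hr]; linarith
  have hrlow : ∀ t ∈ Icc t₀ t₁, -3 * δ ≤ r t := by
    intro t ht
    have : N * (t - t₀) ≤ N * (t₁ - t₀) := by gcongr; exact ht.2
    simp only [hr]; linarith
  have hψneg : ∀ t ∈ Icc t₀ t₁, ∀ x ≤ x₀, -c₀ < κ * (1 - Real.exp (k * (x - r t))) := by
    intro t ht x hx
    have h1 : Real.exp (k * (x - r t)) ≤ Real.exp (k * (x₀ + 3 * δ)) := by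
      gcongr; linarith [hrlow t ht]
    have h2 : κ * Real.exp (k * (x₀ + 3 * δ)) = c₀ := by
      rw [hκ, mul_assoc, ← Real.exp_add]; simp
    have h3 : κ * Real.exp (k * (x - r t)) ≤ c₀ := by rw [← h2]; gcongr
    linarith
  have hψpos : ∀ t x, x < r t → 0 < κ * (1 - Real.exp (k * (x - r t))) := by
    intro t x hx
    have : Real.exp (k * (x - r t)) < 1 := Real.exp_lt_one_iff.2 (mul_neg_of_pos_of_neg (by linarith)
      (by linarith))
    exact mul_pos hκ0 (by linarith)
  have main := h.lt_barrier (ψ := fun t x => κ * (1 - Real.exp (k * (x - r t))))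
    (ψt := fun t x => -(κ * k * N * Real.exp (k * (x - r t))))
    (ψx := fun t x => -(κ * k * Real.exp (k * (x - r t))))
    (ψxx := fun t x => -(κ * k * (k * Real.exp (k * (x - r t))))) (α := -4 * δ) (β := x₀)
    ht₀ ht₁ (by simp only [hr]; fun_prop) ?_ ?_ ?_ ?_ ?_ ?_ ?_ t₁ ⟨ht.le, le_rfl⟩ (-2 * δ)
    ⟨by linarith, by linarith⟩
  · refine main.trans ?_
    rw [hr1]
    have : 1 < Real.exp (k * (-2 * δ - -3 * δ)) := Real.one_lt_exp_iff.2
      (mul_pos (by linarith) (by linarith))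
    exact mul_neg_of_pos_of_neg hκ0 (by linarith)
  · intro t x
    have hrd : HasDerivAt r (-N) t := by
      have := (((hasDerivAt_id t).sub_const t₀).const_mul N).const_sub (x₀ - δ)
      simpa using this
    have := ((((hrd.const_sub x).const_mul k).exp).const_sub 1).const_mul κ
    refine this.congr_deriv ?_
    ring
  · intro t x
    have := (((((hasDerivAt_id x).sub_const (r t)).const_mul k).exp).const_sub 1).const_mul κ
    refine this.congr_deriv ?_
    simp only [id]; ring
  · intro t x
    have := (((((hasDerivAt_id x).sub_const (r t)).const_mul k).exp).const_mul (κ * k)).neg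
    refine this.congr_deriv ?_
    simp only [id]; ring
  · intro x hx
    have htm : t₀ ∈ Icc t₀ t₁ := ⟨le_rfl, ht.le⟩
    rcases lt_or_ge x (x₀ - δ) with hx1 | hx1
    · exact (hle t₀ htm x hx.2).trans_lt (hψpos t₀ x (by simp only [hr]; linarith))
    · exact (hneg t₀ htm x ⟨hx1, hx.2⟩).trans_lt (hψneg t₀ htm x hx.2)
  · intro t ht
    exact (hle t ht _ (by linarith)).trans_lt (hψpos t _ (by linarith [hrlow t ht]))
  · intro t ht
    exact (hneg t ht x₀ ⟨by linarith, le_rfl⟩).trans_lt (hψneg t ht x₀ le_rfl)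
  · intro t ht x hx a b heq _ h1 h2 h3 hineq
    have htI : t ∈ Icc 0 T := ⟨ht₀.trans ht.1.le, ht.2.trans ht₁.le⟩
    have hρt := h.ρ_nonneg hρ htI x
    have hn := h.n_nonneg t htI x
    have hnC := (le_abs_self _).trans (h.reg_n.abs_le t htI x)
    have hρC := (le_abs_self _).trans (h.reg_ρ.abs_le t htI x)
    have hwC := (le_abs_self _).trans (h.reg_w.abs_le t htI x)
    have hs := hsrc t ht x hx.2.le
    rw [← heq] at hineq
    have hex : 0 < Real.exp (k * (x - r t)) := Real.exp_pos _
    have hw : w t x = κ * (1 - Real.exp (k * (x - r t))) := heq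
    set X := Real.exp (k * (x - r t)) with hX
    have hY : 0 < κ * X := by positivity
    have hk0 : 0 < k := by linarith
    have l1 : n t x * (N + w t x) ≤ C * (N + C) :=
      (mul_le_mul_of_nonneg_left (by linarith : N + w t x ≤ N + C) hn).trans (by gcongr)
    have hbn : -(b * deriv (n t) x) ≤ C * C := by
      refine (neg_le_abs _).trans ?_
      rw [abs_mul]
      gcongr
      exact h.reg_n.abs_deriv_le t htI x
    -- The part `ρ u` of the drag is paid for by the pressure; in `-ρ w = -ρ κ + ρ κ X` only the
    -- last term is harmful.
    have l2 : -(ρ t x * w t x) ≤ C * (κ * X) := by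
      have : ρ t x * (κ * X) ≤ C * (κ * X) := by gcongr
      have h5 : 0 ≤ ρ t x * κ := by positivity
      rw [hw]
      linarith
    have l3 : C⁻¹ * k ≤ a * k := by gcongr
    have hfin : C⁻¹ * k * k > C * (N + C) * k + C * C * k + C := by
      have : C⁻¹ * k = C * N + 2 * C ^ 2 + C + C⁻¹ := by rw [hk]; field_simp
      rw [this]
      have hi : 0 < C⁻¹ := by positivity
      nlinarith
    have m1 : n t x * (N + w t x) * (κ * X * k) ≤ C * (N + C) * (κ * X * k) := by gcongr
    have m2 : -(b * deriv (n t) x) * (κ * X * k) ≤ C * C * (κ * X * k) := by gcongr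
    have m3 : C⁻¹ * k * (κ * X * k) ≤ a * k * (κ * X * k) := by gcongr
    have m4 := mul_lt_mul_of_pos_right hfin hY
    linarith

/-- There is no flow starting from initial data with a left layer. -/
theorem not_leftLayer (h : TwoPhaseFlow T C γ ρ u n w) (hT : 0 < T) (hγ : 1 < γ)
    (h0 : LeftLayer γ p M D (ρ 0) (u 0) (n 0) (w 0)) : False := by
  have hC := h.one_le
  have hD := h0.D_pos
  have hp := h0.p_pos
  obtain ⟨W, -, hW⟩ := h.exists_bound_deriv_deriv hT hγ
  obtain ⟨ε, hε, τ₀, hτ₀, δ, hδ, hδD, hτ₀T, hpush⟩ := h.exists_push hT hγ (x₀ := D / 2) (r := D / 8)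
    (by positivity) (fun x hx => h0.w_nonpos x ⟨by linarith [hx.1], by linarith [hx.2]⟩)
    (h0.source_lt hγ ⟨by positivity, by linarith⟩)
  have hsmall : ∀ a b : ℝ, 0 < b → ∀ᶠ s in nhdsWithin (0:ℝ) (Ioi 0), a * s < b := by
    intro a b hb
    have : Continuous fun s : ℝ => a * s := by fun_prop
    exact (this.tendsto' 0 0 (by simp)).mono_left nhdsWithin_le_nhds |>.eventually (gt_mem_nhds hb)
  have hmem : ∀ᶠ s in nhdsWithin (0:ℝ) (Ioi 0), s ∈ Ioo 0 τ₀ := Ioo_mem_nhdsGT hτ₀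
  -- All smallness conditions are linear in `τ`. The condition `C τ < δ` keeps `x ≤ -2 * δ` in the
  -- region at rest.
  obtain ⟨τ, ⟨hτ, hττ⟩, c1, c2, c3, c4, c5⟩ :=
    (hmem.and
    ((hsmall (8 * C) 1 one_pos).and ((hsmall (8 * W) p hp).and ((hsmall C δ hδ).and
    ((hsmall ((γ + 1) * C) 1 one_pos).and (hsmall (C + C * C) M h0.M_pos)))))).exists
  have hτT : τ < T := hττ.trans hτ₀T
  have hfar : ∀ t ∈ Icc 0 τ, ∀ x ≤ -2 * δ, w t x = 0 := by
    intro t ht x hx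
    rcases eq_or_lt_of_le ht.1 with e | e
    · rw [← e]; exact h.w_zero_eq_zero hT h0.vacuum_ρ h0.vacuum_n (by linarith)
    · refine h.w_eq_zero h0.vacuum_ρ h0.vacuum_n ⟨e, ht.2.trans_lt hτT⟩ ?_
      have : C * t ≤ C * τ := by gcongr; exact ht.2
      linarith
  have hpush' : ∀ z ∈ Icc (D / 2 - δ) (D / 2 + δ), ∀ t ∈ Icc 0 τ, w t z ≤ -(ε * t) :=
    fun z hz t ht => hpush z hz t ⟨ht.1, ht.2.trans hττ.le⟩
  have hnonpos := h.w_nonpos hγ h0 hW (x₀ := D / 2) hτT (by linarith) (by linarith) c3.le hδ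
    (by linarith) c5.le (by linarith) (by linarith) hfar
    (fun z hz t ht => (hpush' z hz t ht).trans (neg_nonpos.2 (mul_nonneg hε.le ht.1)))
  have := h.exists_neg h0.ρ_nonneg (t₀ := τ / 2) (t₁ := τ) (x₀ := D / 2) (c₀ := ε * (τ / 2))
    (by positivity) (by linarith) hτT (by positivity) hδ (by positivity) ?_ ?_ ?_
  · rw [hfar τ ⟨hτ.le, le_rfl⟩ _ le_rfl] at this
    exact lt_irrefl _ this
  · intro t ht x hx
    refine (hpush' x ⟨hx.1, by linarith [hx.2]⟩ t ⟨by linarith [ht.1], ht.2⟩).trans ?_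
    have : ε * (τ / 2) ≤ ε * t := by gcongr; exact ht.1
    linarith
  · exact fun t ht x hx => hnonpos t ⟨by linarith [ht.1], ht.2⟩ x (by linarith)
  · intro t ht x hx
    have ht0 : 0 < t := by linarith [ht.1]
    have htT : t ∈ Ioo 0 T := ⟨ht0, ht.2.trans_lt hτT⟩
    have hCt : C * t ≤ C * τ := by gcongr; exact ht.2
    have hWt : W * t ≤ W * τ := by
      have : 0 ≤ W := (abs_nonneg _).trans (hW t htT 0)
      gcongr; exact ht.2
    have cγ : (γ + 1) * (C * t) ≤ (γ + 1) * (C * τ) := by gcongr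
    have cM : (C + C * C) * t ≤ (C + C * C) * τ := by gcongr; exact ht.2
    refine h.drag_le hγ h0 hW htT (by linarith) (by linarith) (by linarith) (by linarith)
      (by linarith) fun hu hρ => ?_
    -- Now that `w ≤ 0` is known, the zero barrier suffices.
    refine h.paths_ordered (ε := 0) (c := 0) (k := 0) (E := D / 2 + δ) htT le_rfl le_rfl
      (by simp) (by linarith) ?_ (by simpa using hu) hρ
    intro s hs y hy
    rw [zero_mul]
    exact hnonpos s ⟨hs.1, hs.2.trans ht.2⟩ y hy

end TwoPhaseFlow

/-! ### Initial data and conclusion -/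

theorem IsSupportedOn.nonneg {f : ℝ → ℝ} {Ω : Set ℝ} (h : IsSupportedOn f Ω) (hf : Continuous f)
    (x : ℝ) : 0 ≤ f x := by
  by_cases hx : x ∈ closure Ω
  · exact closure_minimal (fun y hy => (h.2 y hy).le) (isClosed_le continuous_const hf) hx
  · exact (image_eq_zero_of_notMem_tsupport (by rwa [h.1])).ge

theorem IsSupportedOn.eq_zero {f : ℝ → ℝ} {Ω : Set ℝ} (h : IsSupportedOn f Ω) (hf : Continuous f)
    {a b : ℝ} (hΩ : Ω ⊆ Ioo a b) {x : ℝ} (hx : x ≤ a ∨ b ≤ x) : f x = 0 := by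
  have hout : ∀ y, y ∉ Icc a b → f y = 0 := fun y hy =>
    image_eq_zero_of_notMem_tsupport fun hy' => hy <|
      closure_minimal (hΩ.trans Ioo_subset_Icc_self) isClosed_Icc (h.1 ▸ hy')
  have hcl : IsClosed {y | f y = 0} := isClosed_eq hf continuous_const
  rcases hx with hx | hx
  · have : Iio a ⊆ {y | f y = 0} := fun y hy => hout y fun hy' => absurd hy'.1 (not_le.2 hy)
    exact closure_minimal this hcl (by rwa [closure_Iio])
  · have : Ioi b ⊆ {y | f y = 0} := fun y hy => hout y fun hy' => absurd hy'.2 (not_le.2 hy)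
    exact closure_minimal this hcl (by rwa [closure_Ioi])

theorem drag_bound_of_ratio {γ p M r ν : ℝ} (hγ : 1 < γ) (hp : 0 < p) (hM : 0 < M) (hr : 0 < r)
    (h : (2 : ℝ) ^ (γ + 4) * M / (γ * p) ≤ ν / r) : 16 * M * r ≤ γ * p * ν := by
  rw [div_le_div_iff₀ (by positivity) hr] at h
  have h16 : (16 : ℝ) ≤ 2 ^ (γ + 4) := by
    calc (16 : ℝ) = 2 ^ (4 : ℝ) := by norm_num
      _ ≤ _ := Real.rpow_le_rpow_of_exponent_le (by norm_num) (by linarith)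
  have : 16 * M * r ≤ 2 ^ (γ + 4) * M * r := by gcongr
  linarith

theorem theorem1 (mu : ℝ → ℝ) (γ B K M p₀ d₀ : ℝ) (Ω₁ Ω₂ : Set ℝ) (ρ₀ u₀ n₀ w₀ : ℝ → ℝ)
    (hγ : 1 < γ) (hB : 0 < B) (hmu : ViscosityBounds mu B)
    (hΩ₁ : IsOpen Ω₁) (hΩ₂ : IsOpen Ω₂) (hΩ : Ω₁ ∪ Ω₂ = Set.Ioo 0 1)
    (hρ₀ : IsSupportedOn ρ₀ Ω₁) (hn₀ : IsSupportedOn n₀ Ω₂)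
    (hK : 0 < K) (hM : 0 < M) (hbd : InitialBounds ρ₀ u₀ n₀ w₀ K M)
    (hp₀ : 0 < p₀) (hd₀ : d₀ ∈ Set.Ioo (0 : ℝ) 1)
    (hdata :
      (Ω₁ ⊂ Ω₂ ∧
        ((0 ∉ closure Ω₁ ∧ LeftCondition n₀ w₀ p₀ d₀) ∨
          (1 ∉ closure Ω₁ ∧ RightCondition n₀ w₀ p₀ d₀))) ∨
      (Ω₁ = Ω₂ ∧
        (LeftCondition n₀ w₀ p₀ d₀ ∨ RightCondition n₀ w₀ p₀ d₀) ∧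
        ∀ x ∈ Set.Ioo (0 : ℝ) d₀ ∪ Set.Ioo (1 - d₀) 1,
          (2 : ℝ) ^ (γ + 4) * M / (γ * p₀) ≤ n₀ x ^ γ / ρ₀ x)) :
    ∀ T : ℝ, 0 < T → ∀ m : ℝ, 2 < m →
      ¬ ∃ ρ u n w : ℝ → ℝ → ℝ, IsTwoPhaseSolution mu γ m T ρ₀ u₀ n₀ w₀ ρ u n w := by

  rintro T hT m hm ⟨ρ, u, n, w, hs⟩
  have eρ : ρ 0 = ρ₀ := funext hs.init_ρ
  have eu : u 0 = u₀ := funext hs.init_u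
  have en : n 0 = n₀ := funext hs.init_n
  have ew : w 0 = w₀ := funext hs.init_w
  have h0T : (0 : ℝ) ∈ Icc 0 T := ⟨le_rfl, hT.le⟩
  obtain ⟨_, _, hcρ⟩ := hs.reg_ρ
  obtain ⟨_, _, hcn⟩ := hs.reg_n
  have cρ : Continuous ρ₀ := eρ ▸ (hcρ 0 h0T).1
  have cn : Continuous n₀ := en ▸ (hcn 0 h0T).1
  have hΩ₁' : Ω₁ ⊆ Ioo 0 1 := hΩ ▸ subset_union_left
  have hΩ₂' : Ω₂ = Ioo 0 1 := by
    rcases hdata with ⟨h, -⟩ | ⟨h, -⟩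
    · rwa [union_eq_right.2 h.subset] at hΩ
    · rwa [h, union_self] at hΩ
  have hnpos : ∀ x ∈ Ioo (0 : ℝ) 1, 0 < n₀ x := fun x hx => hn₀.2 x (hΩ₂' ▸ hx)
  have hρ0 := hρ₀.nonneg cρ
  have hd : d₀ < 1 := hd₀.2
  obtain ⟨C, hflow⟩ := hs.exists_twoPhaseFlow hγ hB hmu hT hm (hn₀.nonneg cn)
  have left : ∀ D, 0 < D → D ≤ d₀ → LeftCondition n₀ w₀ p₀ d₀ →
      (∀ x ∈ Ioc 0 D, 16 * M * ρ₀ x ≤ γ * p₀ * n₀ x ^ γ) → False := by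
    intro D hD hDd hL hdrag
    have hin : ∀ x ∈ Ioc 0 D, x ∈ Ioc 0 d₀ := fun x hx => ⟨hx.1, hx.2.trans hDd⟩
    have hin' : ∀ x ∈ Ioc 0 D, x ∈ Ioo (0 : ℝ) 1 := fun x hx => ⟨hx.1, by linarith [hx.2]⟩
    refine hflow.not_leftLayer (p := p₀) (M := M) (D := D) hT hγ ?_
    rw [eρ, eu, en, ew]
    exact {
      D_pos := hD
      p_pos := hp₀
      M_pos := hM
      vacuum_ρ := fun x hx => hρ₀.eq_zero cρ hΩ₁' (.inl hx)
      vacuum_n := fun x hx => hn₀.eq_zero cn hΩ₂'.subset (.inl hx)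
      ρ_nonneg := hρ0
      n_pos := fun x hx => hnpos x (hin' x hx)
      slope := fun x hx => (le_div_iff₀ (hnpos x (hin' x hx))).1 (hL.1 x (hin x hx))
      w_nonpos := fun x hx => hL.2.2 x (hin x hx)
      u_le := fun x hx => (hbd.velocity_u x (hin' x hx)).1.le
      w_le := fun x hx => (hbd.velocity_w x (hin' x hx)).1.le
      drag := hdrag }
  have right : ∀ D, 0 < D → D ≤ d₀ → RightCondition n₀ w₀ p₀ d₀ →
      (∀ x ∈ Ioc 0 D, 16 * M * ρ₀ (1 - x) ≤ γ * p₀ * n₀ (1 - x) ^ γ) → False := by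
    intro D hD hDd hR hdrag
    have hin : ∀ x ∈ Ioc 0 D, 1 - x ∈ Ico (1 - d₀) 1 := fun x hx =>
      ⟨by linarith [hx.2], by linarith [hx.1]⟩
    have hin' : ∀ x ∈ Ioc 0 D, 1 - x ∈ Ioo (0 : ℝ) 1 := fun x hx =>
      ⟨by linarith [hx.2], by linarith [hx.1]⟩
    refine hflow.reflect.not_leftLayer (p := p₀) (M := M) (D := D) hT hγ ?_
    rw [eρ, eu, en, ew]
    exact {
      D_pos := hD
      p_pos := hp₀
      M_pos := hM
      vacuum_ρ := fun x hx => hρ₀.eq_zero cρ hΩ₁' (.inr (by linarith))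
      vacuum_n := fun x hx => hn₀.eq_zero cn hΩ₂'.subset (.inr (by linarith))
      ρ_nonneg := fun x => hρ0 _
      n_pos := fun x hx => hnpos _ (hin' x hx)
      slope := fun x hx => by
        have := (div_le_iff₀ (hnpos _ (hin' x hx))).1 (hR.1 _ (hin x hx))
        rw [deriv_comp_const_sub (f := n₀)]
        linarith
      w_nonpos := fun x hx => neg_nonpos.2 (hR.2.2 _ (hin x hx))
      u_le := fun x hx => by rw [abs_neg]; exact (hbd.velocity_u _ (hin' x hx)).1.le
      w_le := fun x hx => by rw [abs_neg]; exact (hbd.velocity_w _ (hin' x hx)).1.le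
      drag := hdrag }
  -- Without the first phase the drag condition reads `0 ≤ γ p₀ n₀ ^ γ`.
  have hvac : ∀ x, x ∉ closure Ω₁ → 16 * M * ρ₀ x ≤ γ * p₀ * n₀ x ^ γ := by
    intro x hx
    have hn := hn₀.nonneg cn x
    rw [image_eq_zero_of_notMem_tsupport (hρ₀.1 ▸ hx : x ∉ tsupport ρ₀), mul_zero]
    positivity
  have hnear : ∀ a, a ∉ closure Ω₁ → ∃ D, 0 < D ∧ D ≤ d₀ ∧
      ∀ x, |x - a| ≤ D → 16 * M * ρ₀ x ≤ γ * p₀ * n₀ x ^ γ := by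
    intro a ha
    obtain ⟨r, hr, hball⟩ := Metric.isOpen_iff.1 isClosed_closure.isOpen_compl a ha
    refine ⟨min d₀ (r / 2), lt_min hd₀.1 (by positivity), min_le_left _ _, fun x hx => ?_⟩
    refine hvac x (hball ?_)
    rw [Metric.mem_ball, Real.dist_eq]
    linarith [hx.trans (min_le_right d₀ (r / 2))]
  rcases hdata with ⟨-, ⟨h0, hL⟩ | ⟨h1, hR⟩⟩ | ⟨hEq, hLR, hratio⟩
  · obtain ⟨D, hD, hDd, hdrag⟩ := hnear 0 h0
    refine left D hD hDd hL fun x hx => hdrag x ?_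
    rw [sub_zero, abs_of_pos hx.1]
    exact hx.2
  · obtain ⟨D, hD, hDd, hdrag⟩ := hnear 1 h1
    refine right D hD hDd hR fun x hx => hdrag (1 - x) ?_
    rw [sub_sub_cancel_left, abs_neg, abs_of_pos hx.1]
    exact hx.2
  · have hdrag : ∀ x ∈ Ioo (0 : ℝ) 1, x ∈ Ioo 0 d₀ ∪ Ioo (1 - d₀) 1 →
        16 * M * ρ₀ x ≤ γ * p₀ * n₀ x ^ γ := fun x hx hx' =>
      drag_bound_of_ratio hγ hp₀ hM (hρ₀.2 x (by rw [hEq, hΩ₂']; exact hx)) (hratio x hx')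
    have hd2 := hd₀.1
    rcases hLR with hL | hR
    -- The ratio condition is given on the open interval only, while a layer contains its right end;
    -- hence `d₀ / 2`.
    · exact left (d₀ / 2) (by linarith) (by linarith) hL fun x hx =>
        hdrag x ⟨hx.1, by linarith [hx.2]⟩ (.inl ⟨hx.1, by linarith [hx.2]⟩)
    · exact right (d₀ / 2) (by linarith) (by linarith) hR fun x hx =>
        hdrag (1 - x) ⟨by linarith [hx.2], by linarith [hx.1]⟩
          (.inr ⟨by linarith [hx.2], by linarith [hx.1]⟩)
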